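/- Let $\alpha\in\mathbb C\setminus\{0,1\}$ and $\lambda\in\{1,\alpha\}$. **The algebra.** Let $D_\alpha$ be the complex Jordan superalgebra with even basis $e_1,e_2$, odd basis $\xi,\eta$, and supercommutative product $e_i^2=e_i$, $e_1e_2=0$, $e_i\xi=\tfrac12\xi$, $e_i\eta=\tfrac12\eta$, $\xi\eta=e_1+\alpha e_2$, $\xi^2=\eta^2=0$; its unit is $e_1+e_2$. Let $L_a$ denote left multiplication by $a$, let $\mathrm{Der}(D_\alpha)$ be the space of superderivations, and $\mathfrak{str}(D_\alpha)=\{L_a\}\oplus\mathrm{Der}(D_\alpha)$. Let $$\mathfrak g=D_\alpha^-\oplus\mathfrak{str}(D_\alpha)\oplus D_\alpha^+$$ be the Tits–Kantor–Koecher Lie superalgebra (isomorphic to $D(2,1;\alpha)$ when the latter is simple), where $D_\alpha^\pm$ are two copies of $D_\alpha$, abelian, $\mathfrak{str}(D_\alpha)$ carries the supercommutator of operators, and for $x\in D_\alpha^+$, $u\in D_\alpha^-$, $a\in D_\alpha$, $I\in\mathrm{Der}(D_\alpha)$ $$[L_a+I,x]=ax+I x,\qquad [L_a+I,u]=-au+I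 u,\qquad [x,u]=2L_{xu}+2[L_x,L_u].$$ Let $e\in D_\alpha^+$ and $f\in D_\alpha^-$ be the units and $h=2L_{e_1+e_2}$, an $\mathfrak{sl}(2)$-triple. Put $c=\exp(\tfrac{i}{2}\,\mathrm{ad} f)\exp(i\,\mathrm{ad} e)$ (the Cayley transform), $\tilde e=c^{-1}(e)$, $\tilde f=c^{-1}(f)$, $\tilde h=c^{-1}(h)$, $\mathfrak s=\mathrm{span}_{\mathbb C}\{\tilde e,\tilde f,\tilde h\}$ and $\mathfrak k_0=\{T\in\mathfrak{str}(D_\alpha): [T,e]=0\}$. **The representation.** Let $\mathcal P=\mathbb C[z_1,z_2]\otimes\Lambda(z_3,z_4)$, with $z_1,z_2,z_3,z_4$ identified with the basis $e_1,e_2,\xi,\eta$, and put $\partial_i=\partial_{z_i}$. The Bessel operator is the linear map $\mathcal B_\lambda:D_\alpha\to\mathrm{End}(\mathcal P)$ with $$\begin{aligned} \mathcal B_\lambda(z_1)&=-\lambda\partial_1+(z_1\partial_1+z_3\partial_3+z_4\partial_4)\partial_1-2\alpha z_2\partial_3\partial_4,\\ \mathcal B_\lambda(z_2)&=-\tfrac{\lambda}{\alpha}\partial_2+(z_2\partial_2+z_3\partial_3+z_4\partial_4)\partial_2-2z_1\partial_3\partial_4,\\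 \mathcal B_\lambda(z_3)&=-2\lambda\partial_4+2(z_1\partial_1+\alpha z_2\partial_2+(1+\alpha)z_3\partial_3)\partial_4+z_3\partial_1\partial_2,\\ \mathcal B_\lambda(z_4)&=2\lambda\partial_3-2(z_1\partial_1+\alpha z_2\partial_2+(1+\alpha)z_4\partial_4)\partial_3+z_4\partial_1\partial_2. \end{aligned}$$ Define $\pi_\lambda:\mathfrak g\to\mathrm{End}(\mathcal P)$ by $\pi_\lambda(u)=-2i\,u$ (multiplication by the linear polynomial $u$) for $u\in D_\alpha^-$, $\pi_\lambda(T)=\lambda(T)+\sum_i[T,z_i]\,\partial_i$ for $T\in\mathfrak{str}(D_\alpha)$ (with $z_i$ regarded as a basis of $D_\alpha^-$), and $\pi_\lambda(x)=-\tfrac i2\mathcal B_\lambda(x)$ for $x\in D_\alpha^+$; here $T\mapsto\lambda(T)$ is the character of $\mathfrak{str}(D_\alpha)$ with $\lambda(2L_{e_1})=\lambda$, $\lambda(2L_{e_2})=\lambda/\alpha$, vanishing on $L_\xi,L_\eta$ and $\mathrm{Der}(D_\alpha)$. Let $\mathcal I_\lambda\subset\mathcal P$ be the ideal generated by $2z_1z_2+z_3z_4,\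 z_2^2,\ z_2z_3,\ z_2z_4$ if $\lambda=\alpha$, and by $2\alpha z_1z_2+z_3z_4,\ z_1^2,\ z_1z_3,\ z_1z_4$ if $\lambda=1$; it is stable under $\pi_\lambda(\mathfrak g)$. Let $\rho_\lambda=\pi_\lambda\circ c$, acting on $\mathcal P/\mathcal I_\lambda$, and let $F_\lambda=U(\mathfrak g)\cdot 1\subset\mathcal P/\mathcal I_\lambda$ be the subspace generated from $1$ by $\rho_\lambda(\mathfrak g)$. In $\mathcal P/\mathcal I_\lambda$ put $$G_\lambda=\sum_{k\ge0}\mathbb C(z_1+z_2)^k,\qquad H_\lambda=\sum_{k\ge1}H_{\lambda,k},$$ where for $k\ge1$ $$H_{\alpha,k}=\big(\mathbb C(z_1+(k-1-\alpha)z_2)+\mathbb Cz_3+\mathbb Cz_4\big)z_1^{k-1},\qquad H_{1,k}=\big(\mathbb C(z_2+(k-1-\alpha^{-1})z_1)+\mathbb Cz_3+\mathbb Cz_4\big)z_2^{k-1}.$$ **Theorem.** Suppose either $\lambda=\alpha$ and $\alpha\notin\mathbb N\cup\{-1\}$, or $\lambda=1$ and $\alpha^{-1}\notin\mathbb N\cup\{-1\}$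 (with $0\in\mathbb N$). Then: 1. $\{\tilde e,\tilde f,\tilde h\}$ is an $\mathfrak{sl}(2)$-triple: $[\tilde h,\tilde e]=2\tilde e$, $[\tilde h,\tilde f]=-2\tilde f$, $[\tilde e,\tilde f]=\tilde h$; and $\mathfrak s$ and $\mathfrak k_0$ commute, i.e. $[X,Y]=0$ for $X\in\mathfrak s$, $Y\in\mathfrak k_0$. 2. $G_\lambda$ and $H_\lambda$ are invariant under $\rho_\lambda(\mathfrak s)$ and $\rho_\lambda(\mathfrak k_0)$. 3. The sums defining $G_\lambda$ (over $k\ge0$) and $H_\lambda$ (over $k\ge1$) are direct. 4. $F_\lambda=G_\lambda\oplus H_\lambda$, i.e. $G_\lambda\cap H_\lambda=0$ and $G_\lambda+H_\lambda=F_\lambda$. -/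

import Mathlib

open scoped Quaternion

noncomputable section

namespace FockD21

/-! ## The Jordan superalgebra `D_α` -/

/-- The underlying super-vector space `ℂ^{2|2}` of `D_α`; the coordinates `0, 1, 2, 3` belong to the
basis `e₁, e₂` (even), `ξ, η` (odd). -/
abbrev JVec : Type := Fin 4 → ℂ

/-- The parity of the four basis vectors. -/
def par : Fin 4 → ℕ := ![0, 0, 1, 1]

/-- The basis vectors `e₁, e₂, ξ, η`. -/
def bas (i : Fin 4) : JVec := Pi.single i 1

/-- The unit `e₁ + e₂` of `D_α`. -/
def unitJ : JVec := ![1, 1, 0, 0]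

/-- The product of `D_α`: `eᵢ eᵢ = eᵢ`, `e₁ e₂ = 0`, `eᵢ ξ = ξ/2`, `eᵢ η = η/2`,
`ξ η = e₁ + α e₂ = - η ξ`, `ξ ξ = η η = 0`, supercommutative. The linear map `jMul α a` is the left
multiplication `L_a`. -/
def jMul (α : ℂ) : JVec →ₗ[ℂ] Module.End ℂ JVec :=
  LinearMap.mk₂ ℂ
    (fun x y => ![x 0 * y 0 + (x 2 * y 3 - x 3 * y 2),
      x 1 * y 1 + α * (x 2 * y 3 - x 3 * y 2),
      (1 / 2) * ((x 0 + x 1) * y 2 + x 2 * (y 0 + y 1)),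
      (1 / 2) * ((x 0 + x 1) * y 3 + x 3 * (y 0 + y 1))])
    (by intro x x' y; ext i; fin_cases i <;> simp <;> ring)
    (by intro c x y; ext i; fin_cases i <;> simp <;> ring)
    (by intro x y y'; ext i; fin_cases i <;> simp <;> ring)
    (by intro c x y; ext i; fin_cases i <;> simp <;> ring)

/-- The parity involution `v ↦ (-1)^{|v|} v`. -/
def gam : Module.End ℂ JVec where
  toFun v := ![v 0, v 1, -v 2, -v 3]
  map_add' v w := by ext i; fin_cases i <;> simp <;> ring
  map_smul' c v := by ext i; fin_cases i <;> simp

/-- The even part of an endomorphism. -/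
def evenPart (A : Module.End ℂ JVec) : Module.End ℂ JVec := (1 / 2 : ℂ) • (A + gam * A * gam)

/-- The odd part of an endomorphism. -/
def oddPart (A : Module.End ℂ JVec) : Module.End ℂ JVec := (1 / 2 : ℂ) • (A - gam * A * gam)

/-- The supercommutator `[A, B] = A B - (-1)^{|A||B|} B A`, extended bilinearly from homogeneous
endomorphisms (`gam * B * gam` is `(-1)^{|B|} B`). -/
def sComm (A B : Module.End ℂ JVec) : Module.End ℂ JVec :=
  A * B - (B * evenPart A + gam * B * gam * oddPart A)

/-- `(-1)^{|A||v|} A v`, extended bilinearly from homogeneous elements. -/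
def sAct (A : Module.End ℂ JVec) (v : JVec) : JVec := evenPart A v + oddPart A (gam v)

/-- The derivations of `D_α`: the endomorphisms `D` with `[D, L_x] = L_{D x}` for all `x`. -/
def der (α : ℂ) : Submodule ℂ (Module.End ℂ JVec) where
  carrier := {D | ∀ x, sComm D (jMul α x) = jMul α (D x)}
  add_mem' := by
    intro D D' h h' x
    rw [LinearMap.add_apply, map_add, ← h x, ← h' x]
    simp only [sComm, evenPart, oddPart, mul_add, add_mul, smul_add, smul_sub, mul_sub,
      Algebra.mul_smul_comm]
    abel
  zero_mem' := by intro x; simp [sComm, evenPart, oddPart]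
  smul_mem' := by
    intro c D h x
    rw [LinearMap.smul_apply, map_smul, ← h x]
    simp only [sComm, evenPart, oddPart, mul_add, smul_add, smul_sub, mul_sub,
      Algebra.mul_smul_comm, Algebra.smul_mul_assoc, smul_comm c]

/-- The structure algebra `str(D_α) = ⟨L_x⟩ ⊕ Der(D_α)`. -/
def str (α : ℂ) : Submodule ℂ (Module.End ℂ JVec) := LinearMap.range (jMul α) ⊔ der α

/-- For `T = L_a + I` with `I` a derivation this is `-L_a + I`, the action of `T` on `D_α⁻`
(note that `a = T 1`). -/
def dualAct (α : ℂ) (T : Module.End ℂ JVec) : Module.End ℂ JVec :=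
  T - (2 : ℂ) • jMul α (T unitJ)

lemma L_mem_str (α : ℂ) (a : JVec) : jMul α a ∈ str α :=
  Submodule.mem_sup_left ⟨a, rfl⟩

lemma jMul_apply (α : ℂ) (x y : JVec) : jMul α x y =
    ![x 0 * y 0 + (x 2 * y 3 - x 3 * y 2),
      x 1 * y 1 + α * (x 2 * y 3 - x 3 * y 2),
      (1 / 2) * ((x 0 + x 1) * y 2 + x 2 * (y 0 + y 1)),
      (1 / 2) * ((x 0 + x 1) * y 3 + x 3 * (y 0 + y 1))] := rfl

lemma gam_apply (v : JVec) : gam v = ![v 0, v 1, -v 2, -v 3] := rfl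

lemma sComm_apply (A B : Module.End ℂ JVec) (v : JVec) : sComm A B v =
    A (B v) - (1 / 2 : ℂ) • (B (A v) + B (gam (A (gam v))))
      - (1 / 2 : ℂ) • (gam (B (gam (A v))) - gam (B (gam (gam (A (gam v)))))) := by
  simp [sComm, evenPart, oddPart, smul_add, smul_sub]
  abel

/-- The derivations of `D_α` in coordinates. -/
lemma mem_der_iff (α : ℂ) (D : Module.End ℂ JVec) : D ∈ der α ↔
    ∃ a b p q r : ℂ, ∀ v, D v = ![2 * a * v 3 - 2 * b * v 2, -2 * α * a * v 3 + 2 * α * b * v 2,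
      a * (v 1 - v 0) + p * v 2 + q * v 3, b * (v 1 - v 0) + r * v 2 - p * v 3] := by
  constructor
  · intro h
    have hv : ∀ v : JVec, v = v 0 • bas 0 + v 1 • bas 1 + v 2 • bas 2 + v 3 • bas 3 := by
      intro v; ext i; fin_cases i <;> simp [bas]
    have key : ∀ x y : JVec, sComm D (jMul α x) y = jMul α (D x) y := fun x y => by rw [h x]
    set c0 := D (bas 0) with hc0
    set c1 := D (bas 1) with hc1
    set c2 := D (bas 2) with hc2
    set c3 := D (bas 3) with hc3
    have hD : ∀ v : JVec, D v = v 0 • c0 + v 1 • c1 + v 2 • c2 + v 3 • c3 := by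
      intro v; conv_lhs => rw [hv v]
      simp only [map_add, map_smul, hc0, hc1, hc2, hc3]
    have k : ∀ i j l, sComm D (jMul α (bas i)) (bas j) l = jMul α (D (bas i)) (bas j) l :=
      fun i j l => by rw [key]
    simp only [sComm_apply, hD, jMul_apply, gam_apply] at k
    refine ⟨c1 2, c1 3, c2 2, c3 2, c2 3, fun v => ?_⟩
    have k00 := fun l => k 0 0 l
    have k01 := fun l => k 0 1 l
    have k02 := fun l => k 0 2 l
    have k03 := fun l => k 0 3 l
    have k12 := fun l => k 1 2 l
    have k13 := fun l => k 1 3 l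
    have k23 := fun l => k 2 3 l
    simp [bas, Fin.forall_fin_succ, Matrix.vecHead, Matrix.vecTail] at k00 k01 k02 k03 k12 k13 k23
    clear k key h
    rw [hD v]
    ext i
    obtain ⟨a0, a1, a2, a3⟩ := k00
    obtain ⟨b0, b1, b2, b3⟩ := k01
    obtain ⟨e0, e1, e2, e3⟩ := k02
    obtain ⟨f0, f1, f2, f3⟩ := k03
    obtain ⟨g0, g1, g2, g3⟩ := k12
    obtain ⟨m0, m1, m2, m3⟩ := k13
    obtain ⟨n0, n1, n2, n3⟩ := k23
    have z00 : c0 0 = 0 := by linear_combination a0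
    fin_cases i <;> simp
    · linear_combination v 0 * z00 + v 1 * b0 + 2 * v 2 * g0 + 2 * v 3 * m0
    · linear_combination v 0 * a1 - 2 * v 1 * m3 - v 1 * b0 + 2 * v 2 * e1 + 2 * v 3 * f1 + 4 * α * v 2 * b3 - 4 * α * v 3 * b2
    · linear_combination -2 * v 0 * b2
    · linear_combination -2 * v 0 * b3 - v 3 * n0 + v 3 * z00 + α * v 3 * b0
  · rintro ⟨a, b, p, q, r, h⟩ x
    refine LinearMap.ext fun y => funext fun i => ?_
    simp only [sComm_apply, h, jMul_apply, gam_apply]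
    fin_cases i <;> simp <;> ring

lemma mem_str_iff (α : ℂ) (T : Module.End ℂ JVec) :
    T ∈ str α ↔ ∃ a, ∃ D ∈ der α, T = jMul α a + D := by
  rw [str, Submodule.mem_sup]
  constructor
  · rintro ⟨_, ⟨a, rfl⟩, D, hD, rfl⟩; exact ⟨a, D, hD, rfl⟩
  · rintro ⟨a, D, hD, rfl⟩; exact ⟨_, ⟨a, rfl⟩, D, hD, rfl⟩

/-- The supercommutator as a bilinear map. -/
def sCommL : Module.End ℂ JVec →ₗ[ℂ] Module.End ℂ JVec →ₗ[ℂ] Module.End ℂ JVec :=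
  LinearMap.mk₂ ℂ sComm
    (by intro A A' B; refine LinearMap.ext fun v => ?_; simp only [sComm_apply, LinearMap.add_apply, map_add, smul_add, smul_sub]; abel)
    (by intro c A B; refine LinearMap.ext fun v => ?_; simp only [sComm_apply, LinearMap.smul_apply, map_smul, smul_add, smul_sub, smul_comm c])
    (by intro A B B'; refine LinearMap.ext fun v => ?_; simp only [sComm_apply, LinearMap.add_apply, map_add, smul_add, smul_sub]; abel)
    (by intro c A B; refine LinearMap.ext fun v => ?_; simp only [sComm_apply, LinearMap.smul_apply, map_smul, smul_add, smul_sub, smul_comm c])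

lemma sCommL_apply (A B : Module.End ℂ JVec) : sCommL A B = sComm A B := rfl

set_option maxHeartbeats 1600000 in
lemma sComm_mem_str (α : ℂ) {A B : Module.End ℂ JVec} (hA : A ∈ str α) (hB : B ∈ str α) :
    sComm A B ∈ str α := by
  rw [mem_str_iff] at hA hB
  obtain ⟨x, D, hD, rfl⟩ := hA
  obtain ⟨y, D', hD', rfl⟩ := hB
  rw [← sCommL_apply, map_add, map_add, LinearMap.add_apply, LinearMap.add_apply]
  simp only [sCommL_apply]
  have h1 : sComm (jMul α x) (jMul α y) ∈ der α := by
    rw [mem_der_iff]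
    refine ⟨sComm (jMul α x) (jMul α y) (bas 1) 2, sComm (jMul α x) (jMul α y) (bas 1) 3,
      sComm (jMul α x) (jMul α y) (bas 2) 2, sComm (jMul α x) (jMul α y) (bas 3) 2,
      sComm (jMul α x) (jMul α y) (bas 2) 3, fun v => ?_⟩
    ext i
    simp only [sComm_apply, jMul_apply, gam_apply, bas]
    fin_cases i <;> simp <;> ring
  have h2 : sComm D (jMul α y) ∈ str α := by
    rw [hD y]; exact L_mem_str _ _
  have h3 : sComm (jMul α x) D' ∈ str α := by
    have : sComm (jMul α x) D' = jMul α (sComm (jMul α x) D' unitJ) := by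
      rw [mem_der_iff] at hD'
      obtain ⟨a, b, p, q, r, h⟩ := hD'
      refine LinearMap.ext fun v => funext fun i => ?_
      simp only [sComm_apply, jMul_apply, gam_apply, h, unitJ]
      fin_cases i <;> simp <;> ring
    rw [this]; exact L_mem_str _ _
  have h4 : sComm D D' ∈ der α := by
    rw [mem_der_iff] at hD hD' ⊢
    refine ⟨sComm D D' (bas 1) 2, sComm D D' (bas 1) 3, sComm D D' (bas 2) 2, sComm D D' (bas 3) 2,
      sComm D D' (bas 2) 3, fun v => ?_⟩
    obtain ⟨a, b, p, q, r, h⟩ := hD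
    obtain ⟨a', b', p', q', r', h'⟩ := hD'
    ext i
    simp only [sComm_apply, h, h', gam_apply, bas]
    fin_cases i <;> simp [-neg_add_rev, -one_div] <;> ring
  exact add_mem (add_mem (Submodule.mem_sup_right h1) h2)
    (add_mem h3 (Submodule.mem_sup_right h4))

/-! ## The Lie superalgebra `TKK(D_α) = D_α⁻ ⊕ str(D_α) ⊕ D_α⁺ ≅ D(2,1;α)` -/

/-- The super-vector space `D_α⁻ ⊕ str(D_α) ⊕ D_α⁺`, over `ℂ`. -/
abbrev TKK (α : ℂ) : Type := JVec × str α × JVec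

/-- The inclusion of `D_α⁻`, with basis `f₁, f₂, ζ, θ`. -/
def gMinus (α : ℂ) (u : JVec) : TKK α := (u, 0, 0)

/-- The inclusion of `str(D_α)`. -/
def gZero (α : ℂ) (T : str α) : TKK α := (0, T, 0)

/-- The inclusion of `D_α⁺`, with basis `e₁, e₂, ξ, η`. -/
def gPlus (α : ℂ) (x : JVec) : TKK α := (0, 0, x)

lemma dualAct_add (α : ℂ) (S T : Module.End ℂ JVec) :
    dualAct α (S + T) = dualAct α S + dualAct α T := by
  simp only [dualAct, LinearMap.add_apply, map_add, smul_add]; abel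

lemma dualAct_smul (α c : ℂ) (T : Module.End ℂ JVec) :
    dualAct α (c • T) = c • dualAct α T := by
  simp only [dualAct, LinearMap.smul_apply, map_smul, smul_sub, smul_comm c]

lemma sAct_apply (A : Module.End ℂ JVec) (v : JVec) : sAct A v =
    (1 / 2 : ℂ) • (A v + gam (A (gam v))) + (1 / 2 : ℂ) • (A (gam v) - gam (A (gam (gam v)))) := by
  simp [sAct, evenPart, oddPart]

lemma sAct_add_left (A B : Module.End ℂ JVec) (v : JVec) :
    sAct (A + B) v = sAct A v + sAct B v := by
  simp only [sAct_apply, LinearMap.add_apply, map_add, smul_add, smul_sub]; abel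

lemma sAct_smul_left (c : ℂ) (A : Module.End ℂ JVec) (v : JVec) :
    sAct (c • A) v = c • sAct A v := by
  simp only [sAct_apply, LinearMap.smul_apply, map_smul, smul_add, smul_sub, smul_comm c]

lemma sAct_add_right (A : Module.End ℂ JVec) (v w : JVec) :
    sAct A (v + w) = sAct A v + sAct A w := by
  simp only [sAct_apply, map_add, smul_add, smul_sub]; abel

lemma sAct_smul_right (c : ℂ) (A : Module.End ℂ JVec) (v : JVec) :
    sAct A (c • v) = c • sAct A v := by
  simp only [sAct_apply, map_smul, smul_add, smul_sub, smul_comm c]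

/-- The `str(D_α)`-component of the bracket: `[T, S] + [x, v] + [u, y]` with
`[x, v] = 2 L_{x v} + 2 [L_x, L_v]` and
`[u, y] = -(-1)^{|u||y|} [y, u] = -2 L_{u y} + 2 [L_u, L_y]`. -/
def midBracket (α : ℂ) (X Y : TKK α) : str α :=
  ⟨sComm X.2.1 Y.2.1
      + ((2 : ℂ) • jMul α (jMul α X.2.2 Y.1) + (2 : ℂ) • sComm (jMul α X.2.2) (jMul α Y.1))
      + (-((2 : ℂ) • jMul α (jMul α X.1 Y.2.2)) + (2 : ℂ) • sComm (jMul α X.1) (jMul α Y.2.2)),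
    add_mem (add_mem (sComm_mem_str α X.2.1.2 Y.2.1.2)
      (add_mem (Submodule.smul_mem _ _ (L_mem_str α _))
        (Submodule.smul_mem _ _ (sComm_mem_str α (L_mem_str α _) (L_mem_str α _)))))
      (add_mem (neg_mem (Submodule.smul_mem _ _ (L_mem_str α _)))
        (Submodule.smul_mem _ _ (sComm_mem_str α (L_mem_str α _) (L_mem_str α _))))⟩

/-- The Lie superbracket of `TKK(D_α)`: for `x, y ∈ D_α⁺`, `u, v ∈ D_α⁻`, `T, S ∈ str(D_α)`,
`[T, y] = T y`, `[T, v] = dualAct T v`, `[x, S] = -(-1)^{|x||S|} S x`,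
`[u, S] = -(-1)^{|u||S|} dualAct S u`, `[x, y] = [u, v] = 0`. -/
def tkkBracket (α : ℂ) : TKK α →ₗ[ℂ] TKK α →ₗ[ℂ] TKK α :=
  LinearMap.mk₂ ℂ
    (fun X Y => (dualAct α X.2.1 Y.1 - sAct (dualAct α Y.2.1) X.1, midBracket α X Y,
      (X.2.1 : Module.End ℂ JVec) Y.2.2 - sAct Y.2.1 X.2.2))
    (by
      intro X X' Y
      refine Prod.ext ?_ (Prod.ext (Subtype.ext ?_) ?_)
      · simp [dualAct_add, sAct_add_right]; abel
      · simp [midBracket, ← sCommL_apply]; abel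
      · simp [sAct_add_right]; abel)
    (by
      intro c X Y
      refine Prod.ext ?_ (Prod.ext (Subtype.ext ?_) ?_)
      · simp [dualAct_smul, sAct_smul_right, smul_sub]
      · simp [midBracket, ← sCommL_apply, smul_add, smul_comm c]
      · simp [sAct_smul_right, smul_sub])
    (by
      intro X Y Y'
      refine Prod.ext ?_ (Prod.ext (Subtype.ext ?_) ?_)
      · simp [dualAct_add, sAct_add_left]; abel
      · simp [midBracket, ← sCommL_apply]; abel
      · simp [sAct_add_left]; abel)
    (by
      intro c X Y
      refine Prod.ext ?_ (Prod.ext (Subtype.ext ?_) ?_)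
      · simp [dualAct_smul, sAct_smul_left, smul_sub]
      · simp [midBracket, ← sCommL_apply, smul_add, smul_comm c]
      · simp [sAct_smul_left, smul_sub])

/-- The `sl(2)`-triple `e = e₁ + e₂`, `f = f₁ + f₂`, `h = 2 L_e`. -/
def eTri (α : ℂ) : TKK α := gPlus α unitJ

/-- The element `f = f₁ + f₂` of the triple. -/
def fTri (α : ℂ) : TKK α := gMinus α unitJ

/-- The element `h = 2 L_e` of the triple. -/
def hTri (α : ℂ) : TKK α :=
  gZero α ⟨(2 : ℂ) • jMul α unitJ, Submodule.smul_mem _ _ (L_mem_str α _)⟩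

lemma jMul_unitJ (α : ℂ) (v : JVec) : jMul α unitJ v = v := by
  ext i; fin_cases i <;> simp [jMul_apply, unitJ] <;> ring

lemma jMul_unitJ_right (α : ℂ) (v : JVec) : jMul α v unitJ = v := by
  ext i; fin_cases i <;> simp [jMul_apply, unitJ] <;> ring

lemma jMul_unitJ_eq (α : ℂ) : jMul α unitJ = 1 := LinearMap.ext fun v => jMul_unitJ α v

lemma gam_gam : gam * gam = 1 := by
  refine LinearMap.ext fun v => ?_
  ext i; fin_cases i <;> simp [gam_apply]

lemma sComm_one_left (A : Module.End ℂ JVec) : sComm 1 A = 0 := by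
  simp [sComm, evenPart, oddPart, gam_gam, ← two_smul ℂ (1 : Module.End ℂ JVec)]

lemma sComm_one_right (A : Module.End ℂ JVec) : sComm A 1 = 0 := by
  simp only [sComm, evenPart, oddPart, gam_gam, mul_one, one_mul, ← smul_add]
  rw [add_add_sub_cancel, ← two_smul ℂ A, smul_smul]; simp

lemma gam_unitJ : gam unitJ = unitJ := by
  ext i; fin_cases i <;> simp [gam_apply, unitJ]

lemma sAct_unitJ (A : Module.End ℂ JVec) : sAct A unitJ = A unitJ := by
  rw [sAct_apply, gam_unitJ, gam_unitJ, ← smul_add, add_add_sub_cancel, ← two_smul ℂ, smul_smul]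
  simp

lemma dualAct_unitJ (α : ℂ) (A : Module.End ℂ JVec) : dualAct α A unitJ = -(A unitJ) := by
  simp [dualAct, jMul_unitJ_right, two_smul]

lemma ad_e (α : ℂ) (X : TKK α) : tkkBracket α (eTri α) X =
    (0, ⟨(2 : ℂ) • jMul α X.1, Submodule.smul_mem _ _ (L_mem_str α _)⟩,
      -((X.2.1 : Module.End ℂ JVec) unitJ)) := by
  refine Prod.ext ?_ (Prod.ext (Subtype.ext ?_) ?_)
  · simp [tkkBracket, eTri, gPlus, dualAct, sAct]
  · simp [tkkBracket, eTri, gPlus, midBracket, jMul_unitJ_eq, ← sCommL_apply]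
    simp [sCommL_apply, sComm_one_left]
  · simp [tkkBracket, eTri, gPlus, sAct_unitJ]

lemma ad_f (α : ℂ) (X : TKK α) : tkkBracket α (fTri α) X =
    ((X.2.1 : Module.End ℂ JVec) unitJ,
      ⟨(-2 : ℂ) • jMul α X.2.2, Submodule.smul_mem _ _ (L_mem_str α _)⟩, 0) := by
  refine Prod.ext ?_ (Prod.ext (Subtype.ext ?_) ?_)
  · simp [tkkBracket, fTri, gMinus, sAct_unitJ, dualAct_unitJ]
    simp [dualAct]
  · simp [tkkBracket, fTri, gMinus, midBracket, jMul_unitJ_eq, ← sCommL_apply]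
    simp [sCommL_apply, sComm_one_left]
    module
  · simp [tkkBracket, fTri, gMinus, sAct]

lemma ad_e_nilpotent (α : ℂ) : IsNilpotent (tkkBracket α (eTri α)) :=
  ⟨3, LinearMap.ext fun X => by
    simp [pow_succ, ad_e, Prod.ext_iff]⟩

lemma ad_f_nilpotent (α : ℂ) : IsNilpotent (tkkBracket α (fTri α)) :=
  ⟨3, LinearMap.ext fun X => by
    simp [pow_succ, ad_f, Prod.ext_iff]⟩

/-- `exp(T)` for a nilpotent endomorphism `T`, as a linear automorphism. -/
def expEquiv (V : Type*) [AddCommGroup V] [Module ℂ V] (T : Module.End ℂ V)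
    (hT : IsNilpotent T) : V ≃ₗ[ℂ] V :=
  letI : Module ℚ (Module.End ℂ V) := Module.compHom _ (algebraMap ℚ ℂ)
  LinearEquiv.ofLinearMap (IsNilpotent.exp T) (IsNilpotent.exp (-T))
    (IsNilpotent.exp_mul_exp_neg_self hT) (IsNilpotent.exp_neg_mul_exp_self hT)

/-- The Cayley transform `c = exp((i/2) ad f) exp(i ad e)`. -/
def cayley (α : ℂ) : TKK α ≃ₗ[ℂ] TKK α :=
  (expEquiv (TKK α) (Complex.I • tkkBracket α (eTri α)) ((ad_e_nilpotent α).smul _)).trans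
    (expEquiv (TKK α) ((Complex.I / 2) • tkkBracket α (fTri α)) ((ad_f_nilpotent α).smul _))

/-- The transformed triple `ẽ = c⁻¹(e)`, `f̃ = c⁻¹(f)`, `h̃ = c⁻¹(h)`. -/
def eTil (α : ℂ) : TKK α := (cayley α).symm (eTri α)

/-- The element `f̃ = c⁻¹(f)` of the transformed triple. -/
def fTil (α : ℂ) : TKK α := (cayley α).symm (fTri α)

/-- The element `h̃ = c⁻¹(h)` of the transformed triple. -/
def hTil (α : ℂ) : TKK α := (cayley α).symm (hTri α)

/-- The subalgebra `𝔰` spanned by the transformed triple. -/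
def sAlg (α : ℂ) : Submodule ℂ (TKK α) := Submodule.span ℂ {eTil α, fTil α, hTil α}

/-- `𝔨₀ = {a ∈ str(D_α) | [a, e] = 0}` with `e` the unit of `D_α⁺`. -/
def k0 (α : ℂ) : Submodule ℂ (TKK α) where
  carrier := {X | (∃ T : str α, X = gZero α T) ∧ tkkBracket α X (eTri α) = 0}
  add_mem' := by
    rintro _ _ ⟨⟨S, rfl⟩, h⟩ ⟨⟨T, rfl⟩, h'⟩
    exact ⟨⟨S + T, by simp [gZero]⟩, by rw [map_add, LinearMap.add_apply, h, h', add_zero]⟩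
  zero_mem' := ⟨⟨0, rfl⟩, by simp⟩
  smul_mem' := by
    rintro c _ ⟨⟨S, rfl⟩, h⟩
    exact ⟨⟨c • S, by simp [gZero]⟩, by rw [map_smul, LinearMap.smul_apply, h, smul_zero]⟩

/-! ## Superpolynomials -/

/-- The superalgebra `𝒫(ℂ^{2|2}) = ℂ[z₁, z₂] ⊗ Λ(z₃, z₄)` of superpolynomials. It is realised as the
quaternion algebra over `ℂ[z₁, z₂]` with all structure constants equal to zero, which is the
Grassmann algebra on two generators: with `z₃ = i`, `z₄ = j`, `z₃ z₄ = k` one has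
`z₃² = z₄² = 0` and `z₄ z₃ = - z₃ z₄`, and `⟨p, q, r, s⟩ = p + q z₃ + r z₄ + s z₃ z₄`. -/
abbrev SPoly : Type := ℍ[MvPolynomial (Fin 2) ℂ, 0, 0, 0]

/-- The coordinates `z₁, z₂` (even) and `z₃, z₄` (odd). -/
def zv : Fin 4 → SPoly :=
  ![⟨MvPolynomial.X 0, 0, 0, 0⟩, ⟨MvPolynomial.X 1, 0, 0, 0⟩, ⟨0, 1, 0, 0⟩, ⟨0, 0, 1, 0⟩]

lemma zv_two_sq : zv 2 * zv 2 = 0 := by ext1 <;> simp [zv]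

lemma zv_three_sq : zv 3 * zv 3 = 0 := by ext1 <;> simp [zv]

lemma zv_three_two : zv 3 * zv 2 = -(zv 2 * zv 3) := by ext1 <;> simp [zv]

/-- The partial derivatives `∂_{z₁}, ∂_{z₂}`, acting on coefficients. -/
def pdEven (i : Fin 2) : Module.End ℂ SPoly where
  toFun p := ⟨MvPolynomial.pderiv i p.re, MvPolynomial.pderiv i p.imI,
    MvPolynomial.pderiv i p.imJ, MvPolynomial.pderiv i p.imK⟩
  map_add' p q := by ext1 <;> simp
  map_smul' c p := by ext1 <;> simp

/-- The odd derivative `∂_{z₃}`: `z₃ ↦ 1`, `z₄ ↦ 0`, `z₃ z₄ ↦ z₄`. -/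
def pdThree : Module.End ℂ SPoly where
  toFun p := ⟨p.imI, 0, p.imK, 0⟩
  map_add' p q := by ext1 <;> simp
  map_smul' c p := by ext1 <;> simp

/-- The odd derivative `∂_{z₄}`: `z₃ ↦ 0`, `z₄ ↦ 1`, `z₃ z₄ ↦ -z₃`. -/
def pdFour : Module.End ℂ SPoly where
  toFun p := ⟨p.imJ, -p.imK, 0, 0⟩
  map_add' p q := by ext1 <;> simp [add_comm]
  map_smul' c p := by ext1 <;> simp

/-- The partial derivatives `∂_{z₁}, ∂_{z₂}, ∂_{z₃}, ∂_{z₄}`. -/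
def pd : Fin 4 → Module.End ℂ SPoly := ![pdEven 0, pdEven 1, pdThree, pdFour]

/-- The linear superpolynomial `∑ vᵢ zᵢ`. -/
def vecPoly : JVec →ₗ[ℂ] SPoly where
  toFun v := ∑ i, v i • zv i
  map_add' v w := by simp [add_smul, Finset.sum_add_distrib]
  map_smul' c v := by simp [mul_smul, Finset.smul_sum]

/-- Left multiplication by the linear superpolynomial `∑ vᵢ zᵢ`. -/
def mulVec : JVec →ₗ[ℂ] Module.End ℂ SPoly := LinearMap.mul ℂ SPoly ∘ₗ vecPoly

/-! ## The Bessel operator and the polynomial realisation -/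

/-- The character of `str(D_α)` with `λ(2 L_{e₁}) = λ`, `λ(2 L_{e₂}) = λ / α`, vanishing on the odd
`L_a` and on derivations; if `T = L_a + I` with `I` a derivation, then `a = T 1`. -/
def chr (α lam : ℂ) : Module.End ℂ JVec →ₗ[ℂ] ℂ where
  toFun T := (lam * T unitJ 0 + lam / α * T unitJ 1) / 2
  map_add' S T := by simp; ring
  map_smul' c T := by simp; ring

/-- The functional `λ_{fᵢ}(x) = -λ(2 L_{x fᵢ})`. -/
def lamF (α lam : ℂ) (i : Fin 4) : JVec →ₗ[ℂ] ℂ where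
  toFun x := -chr α lam ((2 : ℂ) • jMul α (jMul α x (bas i)))
  map_add' x y := by simp; ring
  map_smul' c x := by simp; ring

/-- `P̃_{fᵢ,fⱼ}(x) = (-1)^{|x|(|i|+|j|)} (L_i L_j + (-1)^{|i||j|} L_j L_i - L_{fᵢ fⱼ})(x)`. -/
def pTilde (α : ℂ) (i j : Fin 4) : Module.End ℂ JVec :=
  (jMul α (bas i) * jMul α (bas j) + ((-1 : ℂ) ^ (par i * par j)) • (jMul α (bas j) * jMul α (bas i))
    - jMul α (jMul α (bas i) (bas j))) * gam ^ (par i + par j)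

/-- The Bessel operator `ℬ_λ(x) = ∑ λ_{fᵢ}(x) ∂ᵢ + ∑ P̃_{fᵢ,fⱼ}(x) ∂ⱼ ∂ᵢ`. -/
def bessel (α lam : ℂ) : JVec →ₗ[ℂ] Module.End ℂ SPoly where
  toFun x := ∑ i, lamF α lam i x • pd i + ∑ i, ∑ j, mulVec (pTilde α i j x) * (pd j * pd i)
  map_add' x y := by
    simp only [map_add, add_smul, add_mul, Finset.sum_add_distrib]
    exact add_add_add_comm _ _ _ _
  map_smul' c x := by
    simp only [map_smul, smul_assoc, Algebra.smul_mul_assoc, ← Finset.smul_sum, ← smul_add]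
    rfl

/-- The action of `str(D_α)` by `λ(T) + ∑ [T, fᵢ] ∂ᵢ`. -/
def pZero (α lam : ℂ) : Module.End ℂ JVec →ₗ[ℂ] Module.End ℂ SPoly where
  toFun T := chr α lam T • 1 + ∑ i, mulVec (dualAct α T (bas i)) * pd i
  map_add' S T := by
    simp only [dualAct_add, LinearMap.add_apply, map_add, add_smul, add_mul,
      Finset.sum_add_distrib]
    exact add_add_add_comm _ _ _ _
  map_smul' c T := by
    simp only [dualAct_smul, LinearMap.smul_apply, map_smul, smul_assoc, Algebra.smul_mul_assoc,
      ← Finset.smul_sum, ← smul_add]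
    rfl

/-- The polynomial realisation `π_λ` of `TKK(D_α)` on `𝒫(ℂ^{2|2})`. In the coordinates `fᵢ` it is
`X` on `D_α⁻`, `λ(X) + ∑ [X, fᵢ] ∂ᵢ` on `str(D_α)` and `-ℬ_λ(X)` on `D_α⁺`; here the coordinates are
rescaled by `fᵢ ↦ -2 i zᵢ`, which turns `ℬ_λ` into `(i/2) ℬ_λ`. -/
def piRep (α lam : ℂ) : TKK α →ₗ[ℂ] Module.End ℂ SPoly where
  toFun X := (-2 * Complex.I) • mulVec X.1 + pZero α lam X.2.1
    - (Complex.I / 2) • bessel α lam X.2.2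
  map_add' X Y := by
    simp only [Prod.fst_add, Prod.snd_add, Submodule.coe_add, map_add, smul_add]
    abel
  map_smul' c X := by
    simp only [Prod.smul_fst, Prod.smul_snd, Submodule.coe_smul, map_smul, RingHom.id_apply,
      smul_add, smul_sub, smul_comm c]

/-! ## The ideal `I_λ` -/

/-- The standing assumptions: `λ ∈ {1, α}`, `α ≠ 0` and `α ≠ 1`. -/
structure Standing (α lam : ℂ) : Prop where
  ne_zero : α ≠ 0
  ne_one : α ≠ 1
  eq_or : lam = α ∨ lam = 1

open scoped Classical in
/-- The spanning set of `V_λ`: `2 z₁ z₂ + z₃ z₄, z₂², z₂ z₃, z₂ z₄` if `λ = α`, and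
`2 α z₁ z₂ + z₃ z₄, z₁², z₁ z₃, z₁ z₄` if `λ = 1`. -/
def vGen (α lam : ℂ) : Set SPoly :=
  if lam = α then
    {(2 : ℂ) • (zv 0 * zv 1) + zv 2 * zv 3, zv 1 * zv 1, zv 1 * zv 2, zv 1 * zv 3}
  else
    {(2 * α) • (zv 0 * zv 1) + zv 2 * zv 3, zv 0 * zv 0, zv 0 * zv 2, zv 0 * zv 3}

/-- `I_λ = 𝒫(ℂ^{2|2}) V_λ`, as a subspace of `𝒫(ℂ^{2|2})`. -/
def idealI (α lam : ℂ) : Submodule ℂ SPoly := (Ideal.span (vGen α lam)).restrictScalars ℂ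

lemma mul_mem_of_zv_mul_mem (M : Submodule ℂ SPoly) (h : ∀ i, ∀ q ∈ M, zv i * q ∈ M)
    (p : SPoly) {q : SPoly} (hq : q ∈ M) : p * q ∈ M := by
  have h0 : ∀ (f : MvPolynomial (Fin 2) ℂ), ∀ q ∈ M, (⟨f, 0, 0, 0⟩ : SPoly) * q ∈ M := by
    intro f
    induction f using MvPolynomial.induction_on with
    | C a =>
      intro q hq
      convert M.smul_mem a hq using 1
      ext1 <;> simp [MvPolynomial.smul_eq_C_mul]
    | add f g hf hg =>
      intro q hq
      convert M.add_mem (hf q hq) (hg q hq) using 1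
      ext1 <;> simp [add_mul]
    | mul_X f i hf =>
      intro q hq
      fin_cases i
      · convert hf _ (h 0 q hq) using 1
        ext1 <;> simp [zv, mul_assoc]
      · convert hf _ (h 1 q hq) using 1
        ext1 <;> simp [zv, mul_assoc]
  have e : p * q = (⟨p.re, 0, 0, 0⟩ : SPoly) * q + (⟨p.imI, 0, 0, 0⟩ : SPoly) * (zv 2 * q)
      + (⟨p.imJ, 0, 0, 0⟩ : SPoly) * (zv 3 * q)
      + (⟨p.imK, 0, 0, 0⟩ : SPoly) * (zv 2 * (zv 3 * q)) := by
    ext1 <;> simp [zv] <;> ring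
  rw [e]
  exact M.add_mem (M.add_mem (M.add_mem (h0 _ _ hq) (h0 _ _ (h 2 _ hq))) (h0 _ _ (h 3 _ hq)))
    (h0 _ _ (h 2 _ (h 3 _ hq)))

lemma mul_mem_idealI (α lam : ℂ) (p : SPoly) {q : SPoly} (hq : q ∈ idealI α lam) :
    p * q ∈ idealI α lam :=
  Ideal.mul_mem_left _ p hq

lemma idealI_stable {α lam : ℂ} (T : Module.End ℂ SPoly)
    (h0 : ∀ v ∈ vGen α lam, T v ∈ idealI α lam)
    (h1 : ∀ i, ∀ q ∈ idealI α lam, T q ∈ idealI α lam → T (zv i * q) ∈ idealI α lam) :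
    ∀ q ∈ idealI α lam, T q ∈ idealI α lam := by
  have key : ∀ q ∈ Ideal.span (vGen α lam), q ∈ idealI α lam ⊓ (idealI α lam).comap T := by
    intro q hq
    induction hq using Submodule.span_induction with
    | mem x hx => exact ⟨Ideal.subset_span hx, h0 x hx⟩
    | zero => exact zero_mem _
    | add x y _ _ hx hy => exact add_mem hx hy
    | smul a x _ hx =>
      exact mul_mem_of_zv_mul_mem _
        (fun i q hq => Submodule.mem_inf.2 ⟨mul_mem_idealI α lam _ hq.1, h1 i q hq.1 hq.2⟩) a hx
  exact fun q hq => (key q hq).2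

lemma vecPoly_eq (v : JVec) : vecPoly v =
    ⟨MvPolynomial.C (v 0) * MvPolynomial.X 0 + MvPolynomial.C (v 1) * MvPolynomial.X 1,
      MvPolynomial.C (v 2), MvPolynomial.C (v 3), 0⟩ := by
  ext1 <;> simp [vecPoly, zv, Fin.sum_univ_four, MvPolynomial.smul_eq_C_mul]

lemma bas_eq : bas 0 = ![1, 0, 0, 0] ∧ bas 1 = ![0, 1, 0, 0] ∧ bas 2 = ![0, 0, 1, 0] ∧
    bas 3 = ![0, 0, 0, 1] := by
  refine ⟨?_, ?_, ?_, ?_⟩ <;> · ext l; fin_cases l <;> simp [bas]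

lemma pTilde_apply (α : ℂ) (i j : Fin 4) (x : JVec) : pTilde α i j x =
    jMul α (bas i) (jMul α (bas j) ((gam ^ (par i + par j)) x))
    + ((-1 : ℂ) ^ (par i * par j)) • jMul α (bas j) (jMul α (bas i) ((gam ^ (par i + par j)) x))
    - jMul α (jMul α (bas i) (bas j)) ((gam ^ (par i + par j)) x) := rfl

set_option maxHeartbeats 1600000 in
lemma pTilde_table (α : ℂ) (x : JVec) :
    pTilde α 0 0 x = ![x 0, 0, 0, 0] ∧ pTilde α 1 1 x = ![0, x 1, 0, 0] ∧
    pTilde α 2 2 x = 0 ∧ pTilde α 3 3 x = 0 ∧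
    pTilde α 0 1 x = ![0, 0, x 2 / 2, x 3 / 2] ∧ pTilde α 1 0 x = ![0, 0, x 2 / 2, x 3 / 2] ∧
    pTilde α 0 2 x = ![-x 3, 0, x 0 / 2, 0] ∧ pTilde α 2 0 x = ![-x 3, 0, x 0 / 2, 0] ∧
    pTilde α 0 3 x = ![x 2, 0, 0, x 0 / 2] ∧ pTilde α 3 0 x = ![x 2, 0, 0, x 0 / 2] ∧
    pTilde α 1 2 x = ![0, -α * x 3, x 1 / 2, 0] ∧ pTilde α 2 1 x = ![0, -α * x 3, x 1 / 2, 0] ∧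
    pTilde α 1 3 x = ![0, α * x 2, 0, x 1 / 2] ∧ pTilde α 3 1 x = ![0, α * x 2, 0, x 1 / 2] ∧
    pTilde α 2 3 x = ![x 1, α * x 0, -(1 + α) * x 2, -(1 + α) * x 3] ∧
    pTilde α 3 2 x = -![x 1, α * x 0, -(1 + α) * x 2, -(1 + α) * x 3] := by
  have e := bas_eq
  refine ⟨?_, ?_, ?_, ?_, ?_, ?_, ?_, ?_, ?_, ?_, ?_, ?_, ?_, ?_, ?_, ?_⟩ <;>
  · simp only [pTilde_apply, e, par, jMul_apply]
    ext l
    fin_cases l <;> simp [gam_apply, gam_gam, pow_succ] <;> ring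

lemma lamF_table (α lam : ℂ) (x : JVec) : lamF α lam 0 x = -lam * x 0 ∧
    lamF α lam 1 x = -(lam / α) * x 1 ∧
    lamF α lam 2 x = (lam + lam / α * α) * x 3 ∧ lamF α lam 3 x = -(lam + lam / α * α) * x 2 := by
  have e := bas_eq
  refine ⟨?_, ?_, ?_, ?_⟩ <;>
  · simp [lamF, chr, e, jMul_apply, unitJ]; try ring

lemma mulVec_apply (v : JVec) (q : SPoly) : mulVec v q = vecPoly v * q := rfl

lemma pd_eq : pd 0 = pdEven 0 ∧ pd 1 = pdEven 1 ∧ pd 2 = pdThree ∧ pd 3 = pdFour :=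
  ⟨rfl, rfl, rfl, rfl⟩

lemma pdEven_apply (i : Fin 2) (p : SPoly) : pdEven i p =
    ⟨MvPolynomial.pderiv i p.re, MvPolynomial.pderiv i p.imI,
    MvPolynomial.pderiv i p.imJ, MvPolynomial.pderiv i p.imK⟩ := rfl

lemma pdThree_apply (p : SPoly) : pdThree p = ⟨p.imI, 0, p.imK, 0⟩ := rfl

lemma pdFour_apply (p : SPoly) : pdFour p = ⟨p.imJ, -p.imK, 0, 0⟩ := rfl

lemma zv_eq : zv 0 = ⟨MvPolynomial.X 0, 0, 0, 0⟩ ∧ zv 1 = ⟨MvPolynomial.X 1, 0, 0, 0⟩ ∧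
    zv 2 = ⟨0, 1, 0, 0⟩ ∧ zv 3 = ⟨0, 0, 1, 0⟩ := ⟨rfl, rfl, rfl, rfl⟩

lemma pderiv_comm (i j : Fin 2) (p : MvPolynomial (Fin 2) ℂ) :
    MvPolynomial.pderiv i (MvPolynomial.pderiv j p)
      = MvPolynomial.pderiv j (MvPolynomial.pderiv i p) := by
  let d : Fin 2 → Derivation ℂ (MvPolynomial (Fin 2) ℂ) (MvPolynomial (Fin 2) ℂ) :=
    fun i => MvPolynomial.pderiv i
  have h : ⁅d i, d j⁆ = 0 := by
    refine MvPolynomial.derivation_ext fun k => ?_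
    rw [Derivation.commutator_apply]
    simp only [d, MvPolynomial.pderiv_X, Pi.single_apply]
    split_ifs <;> simp
  have h' := DFunLike.congr_fun h p
  rwa [Derivation.commutator_apply, Derivation.zero_apply, sub_eq_zero] at h'

/-- The Leibniz rules for the coordinates. -/
lemma leib (f : SPoly) :
    (pd 0 (zv 0 * f) = f + zv 0 * pd 0 f ∧ pd 0 (zv 1 * f) = zv 1 * pd 0 f ∧
      pd 0 (zv 2 * f) = zv 2 * pd 0 f ∧ pd 0 (zv 3 * f) = zv 3 * pd 0 f) ∧
    (pd 1 (zv 0 * f) = zv 0 * pd 1 f ∧ pd 1 (zv 1 * f) = f + zv 1 * pd 1 f ∧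
      pd 1 (zv 2 * f) = zv 2 * pd 1 f ∧ pd 1 (zv 3 * f) = zv 3 * pd 1 f) ∧
    (pd 2 (zv 0 * f) = zv 0 * pd 2 f ∧ pd 2 (zv 1 * f) = zv 1 * pd 2 f ∧
      pd 2 (zv 2 * f) = f - zv 2 * pd 2 f ∧ pd 2 (zv 3 * f) = -(zv 3 * pd 2 f)) ∧
    (pd 3 (zv 0 * f) = zv 0 * pd 3 f ∧ pd 3 (zv 1 * f) = zv 1 * pd 3 f ∧
      pd 3 (zv 2 * f) = -(zv 2 * pd 3 f) ∧ pd 3 (zv 3 * f) = f - zv 3 * pd 3 f) := by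
  simp only [pd_eq, pdEven_apply, pdThree_apply, pdFour_apply, zv_eq]
  refine ⟨⟨?_, ?_, ?_, ?_⟩, ⟨?_, ?_, ?_, ?_⟩, ⟨?_, ?_, ?_, ?_⟩, ⟨?_, ?_, ?_, ?_⟩⟩ <;>
    ext1 <;> simp [MvPolynomial.pderiv_X] <;> ring

/-- The (anti)commutation rules of the coordinates and of the derivatives. -/
lemma zv_swap (f : SPoly) :
    (zv 1 * (zv 0 * f) = zv 0 * (zv 1 * f) ∧ zv 2 * (zv 0 * f) = zv 0 * (zv 2 * f) ∧
      zv 3 * (zv 0 * f) = zv 0 * (zv 3 * f) ∧ zv 2 * (zv 1 * f) = zv 1 * (zv 2 * f) ∧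
      zv 3 * (zv 1 * f) = zv 1 * (zv 3 * f) ∧ zv 3 * (zv 2 * f) = -(zv 2 * (zv 3 * f)) ∧
      zv 2 * (zv 2 * f) = 0 ∧ zv 3 * (zv 3 * f) = 0) ∧
    (pd 1 (pd 0 f) = pd 0 (pd 1 f) ∧ pd 2 (pd 0 f) = pd 0 (pd 2 f) ∧
      pd 3 (pd 0 f) = pd 0 (pd 3 f) ∧ pd 2 (pd 1 f) = pd 1 (pd 2 f) ∧
      pd 3 (pd 1 f) = pd 1 (pd 3 f) ∧ pd 3 (pd 2 f) = -pd 2 (pd 3 f) ∧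
      pd 2 (pd 2 f) = 0 ∧ pd 3 (pd 3 f) = 0) := by
  simp only [pd_eq, pdEven_apply, pdThree_apply, pdFour_apply, zv_eq]
  refine ⟨⟨?_, ?_, ?_, ?_, ?_, ?_, ?_, ?_⟩, ⟨?_, ?_, ?_, ?_, ?_, ?_, ?_, ?_⟩⟩ <;>
    ext1 <;> simp [pderiv_comm 1 0] <;> ring

/-- The values of the coordinates, and products of two coordinates. -/
lemma zv_vals :
    (pd 0 (zv 0) = 1 ∧ pd 0 (zv 1) = 0 ∧ pd 0 (zv 2) = 0 ∧ pd 0 (zv 3) = 0) ∧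
    (pd 1 (zv 0) = 0 ∧ pd 1 (zv 1) = 1 ∧ pd 1 (zv 2) = 0 ∧ pd 1 (zv 3) = 0) ∧
    (pd 2 (zv 0) = 0 ∧ pd 2 (zv 1) = 0 ∧ pd 2 (zv 2) = 1 ∧ pd 2 (zv 3) = 0) ∧
    (pd 3 (zv 0) = 0 ∧ pd 3 (zv 1) = 0 ∧ pd 3 (zv 2) = 0 ∧ pd 3 (zv 3) = 1) ∧
    (pd 0 1 = 0 ∧ pd 1 1 = 0 ∧ pd 2 1 = 0 ∧ pd 3 1 = 0) ∧
    (zv 1 * zv 0 = zv 0 * zv 1 ∧ zv 2 * zv 0 = zv 0 * zv 2 ∧ zv 3 * zv 0 = zv 0 * zv 3 ∧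
      zv 2 * zv 1 = zv 1 * zv 2 ∧ zv 3 * zv 1 = zv 1 * zv 3 ∧ zv 3 * zv 2 = -(zv 2 * zv 3) ∧
      zv 2 * zv 2 = 0 ∧ zv 3 * zv 3 = 0) := by
  simp only [pd_eq, pdEven_apply, pdThree_apply, pdFour_apply, zv_eq]
  refine ⟨⟨?_, ?_, ?_, ?_⟩, ⟨?_, ?_, ?_, ?_⟩, ⟨?_, ?_, ?_, ?_⟩, ⟨?_, ?_, ?_, ?_⟩,
      ⟨?_, ?_, ?_, ?_⟩, ⟨?_, ?_, ?_, ?_, ?_, ?_, ?_, ?_⟩⟩ <;>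
    ext1 <;> simp [MvPolynomial.pderiv_X] <;> ring

lemma vecPoly_mul (v : JVec) (f : SPoly) : vecPoly v * f =
    v 0 • (zv 0 * f) + v 1 • (zv 1 * f) + v 2 • (zv 2 * f) + v 3 • (zv 3 * f) := by
  simp [vecPoly, Fin.sum_univ_four, add_mul]

set_option maxHeartbeats 1600000 in
/-- The Bessel operator in coordinates. -/
lemma bessel_apply (α lam : ℂ) (x : JVec) (q : SPoly) : bessel α lam x q =
    x 0 • (-lam • pd 0 q + zv 0 * pd 0 (pd 0 q) + zv 2 * pd 2 (pd 0 q) + zv 3 * pd 3 (pd 0 q)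
      - (2 * α) • (zv 1 * pd 2 (pd 3 q)))
    + x 1 • (-(lam / α) • pd 1 q + zv 1 * pd 1 (pd 1 q) + zv 2 * pd 2 (pd 1 q)
      + zv 3 * pd 3 (pd 1 q) - (2 : ℂ) • (zv 0 * pd 2 (pd 3 q)))
    + x 2 • (-(lam + lam / α * α) • pd 3 q + (2 : ℂ) • (zv 0 * pd 0 (pd 3 q))
      + (2 * α) • (zv 1 * pd 1 (pd 3 q)) + (2 * (1 + α)) • (zv 2 * pd 2 (pd 3 q))
      + zv 2 * pd 0 (pd 1 q))
    + x 3 • ((lam + lam / α * α) • pd 2 q - (2 : ℂ) • (zv 0 * pd 0 (pd 2 q))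
      - (2 * α) • (zv 1 * pd 1 (pd 2 q)) - (2 * (1 + α)) • (zv 3 * pd 3 (pd 2 q))
      + zv 3 * pd 0 (pd 1 q)) := by
  obtain ⟨h00, h11, h22, h33, h01, h10, h02, h20, h03, h30, h12, h21, h13, h31, h23, h32⟩ :=
    pTilde_table α x
  obtain ⟨l0, l1, l2, l3⟩ := lamF_table α lam x
  have hb : bessel α lam x q = ∑ i, lamF α lam i x • pd i q
      + ∑ i, ∑ j, vecPoly (pTilde α i j x) * (pd j (pd i q)) := by
    simp [bessel, mulVec_apply, LinearMap.sum_apply]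
  simp only [hb, Fin.sum_univ_four, h00, h11, h22, h33, h01, h10, h02, h20, h03, h30, h12, h21,
    h13, h31, h23, h32, l0, l1, l2, l3, vecPoly_mul, map_neg, map_zero, neg_mul, zero_mul, zv_swap,
    mul_neg]
  simp
  obtain ⟨m, hm⟩ : ∃ m : SPoly → SPoly → SPoly, ∀ a b, a * b = m a b := ⟨_, fun _ _ => rfl⟩
  simp only [hm]
  module

/-- `2 L_A + D` acts on `𝒫(ℂ^{2|2})` by this operator, where `D` is the derivation with parameters
`u, v, p, q, r`. -/
def strOp (α lam A0 A1 A2 A3 u v p q r : ℂ) : Module.End ℂ SPoly :=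
  (lam * A0 + lam / α * A1) • 1
    + mulVec ![-2 * A0, 0, -(u + A2), -(v + A3)] * pd 0
    + mulVec ![0, -2 * A1, u - A2, v - A3] * pd 1
    + mulVec ![2 * (A3 - v), 2 * α * (A3 + v), p - (A0 + A1), r] * pd 2
    + mulVec ![2 * (u - A2), -(2 * α * (A2 + u)), q, -p - (A0 + A1)] * pd 3

set_option maxHeartbeats 800000 in
lemma pZero_eq_strOp (α lam : ℂ) {T : Module.End ℂ JVec} (hT : T ∈ str α) :
    ∃ A0 A1 A2 A3 u v p q r : ℂ, pZero α lam T = strOp α lam A0 A1 A2 A3 u v p q r := by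
  obtain ⟨a, D, hD, rfl⟩ := (mem_str_iff α T).1 hT
  obtain ⟨u, v, p, q, r, h⟩ := (mem_der_iff α D).1 hD
  refine ⟨a 0 / 2, a 1 / 2, a 2 / 2, a 3 / 2, u, v, p, q, r, ?_⟩
  have e := bas_eq
  have hu : D unitJ = 0 := by
    rw [h]; ext l; fin_cases l <;> simp [unitJ]
  have hc : chr α lam (jMul α a + D) = lam * (a 0 / 2) + lam / α * (a 1 / 2) := by
    simp [chr, hu, jMul_unitJ_right]; ring
  have hd : ∀ w, dualAct α (jMul α a + D) w = D w - jMul α a w := by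
    intro w
    simp [dualAct, hu, jMul_unitJ_right, two_smul]
  simp only [pZero, strOp, LinearMap.coe_mk, AddHom.coe_mk, hc, hd, Fin.sum_univ_four, e, h,
    jMul_apply, ← add_assoc]
  congr <;> simp <;> ring_nf <;> simp

lemma strOp_apply (α lam A0 A1 A2 A3 u v p q r : ℂ) (f : SPoly) :
    strOp α lam A0 A1 A2 A3 u v p q r f = (lam * A0 + lam / α * A1) • f
    + ((-2 * A0) • (zv 0 * pd 0 f) - (u + A2) • (zv 2 * pd 0 f) - (v + A3) • (zv 3 * pd 0 f))
    + ((-2 * A1) • (zv 1 * pd 1 f) + (u - A2) • (zv 2 * pd 1 f) + (v - A3) • (zv 3 * pd 1 f))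
    + ((2 * (A3 - v)) • (zv 0 * pd 2 f) + (2 * α * (A3 + v)) • (zv 1 * pd 2 f)
      + (p - (A0 + A1)) • (zv 2 * pd 2 f) + r • (zv 3 * pd 2 f))
    + ((2 * (u - A2)) • (zv 0 * pd 3 f) - (2 * α * (A2 + u)) • (zv 1 * pd 3 f)
      + q • (zv 2 * pd 3 f) + (-p - (A0 + A1)) • (zv 3 * pd 3 f)) := by
  obtain ⟨m, hm⟩ : ∃ m : SPoly → SPoly → SPoly, ∀ a b, a * b = m a b := ⟨_, fun _ _ => rfl⟩
  simp [strOp, mulVec_apply, vecPoly_mul]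
  simp only [hm]
  module

lemma strOp_split (α lam A0 A1 A2 A3 u v p q r : ℂ) :
    strOp α lam A0 A1 A2 A3 u v p q r =
      strOp α lam A0 A1 0 0 0 0 p q r + strOp α lam 0 0 A2 A3 u v 0 0 0 := by
  refine LinearMap.ext fun f => ?_
  obtain ⟨m, hm⟩ : ∃ m : SPoly → SPoly → SPoly, ∀ a b, a * b = m a b := ⟨_, fun _ _ => rfl⟩
  simp only [LinearMap.add_apply, strOp_apply, hm]
  module

lemma strOp_even_mul (α lam A0 A1 p q r : ℂ) (i : Fin 4) (f : SPoly) :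
    ∃ g : SPoly, strOp α lam A0 A1 0 0 0 0 p q r (zv i * f)
      = zv i * strOp α lam A0 A1 0 0 0 0 p q r f + g * f := by
  refine ⟨vecPoly (![![-2 * A0, 0, 0, 0], ![0, -2 * A1, 0, 0], ![0, 0, p - (A0 + A1), r],
    ![0, 0, q, -p - (A0 + A1)]] i), ?_⟩
  rw [vecPoly_mul]
  obtain ⟨m, hm⟩ : ∃ m : SPoly → SPoly → SPoly, ∀ a b, a * b = m a b := ⟨_, fun _ _ => rfl⟩
  fin_cases i <;> simp [strOp_apply, leib, zv_swap, mul_add, mul_sub] <;> simp only [hm] <;> module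

lemma strOp_odd_mul (α lam A2 A3 u v : ℂ) (i : Fin 4) (f : SPoly) :
    ∃ g : SPoly, strOp α lam 0 0 A2 A3 u v 0 0 0 (zv i * f)
      = ((-1 : ℂ) ^ par i) • (zv i * strOp α lam 0 0 A2 A3 u v 0 0 0 f) + g * f := by
  refine ⟨vecPoly (![![0, 0, -(u + A2), -(v + A3)], ![0, 0, u - A2, v - A3],
    ![2 * (A3 - v), 2 * α * (A3 + v), 0, 0], ![2 * (u - A2), -(2 * α * (A2 + u)), 0, 0]] i), ?_⟩
  rw [vecPoly_mul]
  obtain ⟨m, hm⟩ : ∃ m : SPoly → SPoly → SPoly, ∀ a b, a * b = m a b := ⟨_, fun _ _ => rfl⟩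
  fin_cases i <;> simp [strOp_apply, leib, zv_swap, mul_add, mul_sub, par] <;> simp only [hm] <;> module

set_option maxHeartbeats 1600000 in
lemma bessel_even_mul (α lam x0 x1 : ℂ) (i : Fin 4) (f : SPoly) :
    ∃ A0 A1 A2 A3 u v p q r : ℂ, bessel α lam ![x0, x1, 0, 0] (zv i * f)
      = zv i * bessel α lam ![x0, x1, 0, 0] f - strOp α lam A0 A1 A2 A3 u v p q r f := by
  obtain ⟨y0, rfl⟩ : ∃ y, x0 = 2 * y := ⟨x0 / 2, by ring⟩
  obtain ⟨y1, rfl⟩ : ∃ y, x1 = 2 * y := ⟨x1 / 2, by ring⟩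
  generalize hl : lam / α = l
  refine ⟨![2 * y0, 0, 0, 0] i, ![0, 2 * y1, 0, 0] i, ![0, 0, y0 + y1, 0] i,
    ![0, 0, 0, y0 + y1] i, ![0, 0, y0 - y1, 0] i, ![0, 0, 0, y0 - y1] i, 0, 0, 0, ?_⟩
  obtain ⟨m, hm⟩ : ∃ m : SPoly → SPoly → SPoly, ∀ a b, a * b = m a b := ⟨_, fun _ _ => rfl⟩
  fin_cases i <;>
    simp [bessel_apply, strOp_apply, leib, zv_swap, mul_add, mul_sub, hl] <;> simp only [hm] <;> module

set_option maxHeartbeats 1600000 in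
lemma bessel_odd_mul (α lam x2 x3 : ℂ) (i : Fin 4) (f : SPoly) :
    ∃ A0 A1 A2 A3 u v p q r : ℂ, bessel α lam ![0, 0, x2, x3] (zv i * f)
      = ((-1 : ℂ) ^ par i) • (zv i * bessel α lam ![0, 0, x2, x3] f)
        - strOp α lam A0 A1 A2 A3 u v p q r f := by
  obtain ⟨y2, rfl⟩ : ∃ y, x2 = 2 * y := ⟨x2 / 2, by ring⟩
  obtain ⟨y3, rfl⟩ : ∃ y, x3 = 2 * y := ⟨x3 / 2, by ring⟩
  generalize hl : lam / α = l
  refine ⟨![0, 0, -2 * y3, 2 * y2] i, ![0, 0, -2 * α * y3, 2 * α * y2] i, ![y2, y2, 0, 0] i,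
    ![y3, y3, 0, 0] i, ![-y2, y2, 0, 0] i, ![-y3, y3, 0, 0] i,
    ![0, 0, -2 * (1 + α) * y3, -2 * (1 + α) * y2] i, ![0, 0, 4 * (1 + α) * y2, 0] i,
    ![0, 0, 0, -4 * (1 + α) * y3] i, ?_⟩
  obtain ⟨m, hm⟩ : ∃ m : SPoly → SPoly → SPoly, ∀ a b, a * b = m a b := ⟨_, fun _ _ => rfl⟩
  fin_cases i <;>
    simp [bessel_apply, strOp_apply, leib, zv_swap, mul_add, mul_sub, par, hl] <;> simp only [hm] <;> module

lemma mem_idealI_of_vGen {α lam : ℂ} {w : SPoly} (h : w ∈ vGen α lam) : w ∈ idealI α lam :=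
  Ideal.subset_span h

lemma lin_mem_idealI {α lam : ℂ} {r0 r1 r2 r3 : SPoly} (h0 : r0 ∈ idealI α lam)
    (h1 : r1 ∈ idealI α lam) (h2 : r2 ∈ idealI α lam) (h3 : r3 ∈ idealI α lam) (a b c d : ℂ) :
    a • r0 + b • r1 + c • r2 + d • r3 ∈ idealI α lam :=
  add_mem (add_mem (add_mem (Submodule.smul_mem _ _ h0) (Submodule.smul_mem _ _ h1))
    (Submodule.smul_mem _ _ h2)) (Submodule.smul_mem _ _ h3)

set_option maxHeartbeats 1600000 in
lemma strOp_vGen {α lam : ℂ} (A0 A1 A2 A3 u v p q r : ℂ) :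
    ∀ w ∈ vGen α lam, strOp α lam A0 A1 A2 A3 u v p q r w ∈ idealI α lam := by
  have hv := @mem_idealI_of_vGen α lam
  obtain ⟨m, hm⟩ : ∃ m : SPoly → SPoly → SPoly, ∀ a b, a * b = m a b := ⟨_, fun _ _ => rfl⟩
  by_cases hc : lam = α
  · simp only [vGen, if_pos hc, Set.mem_insert_iff, Set.mem_singleton_iff, forall_eq_or_imp,
      forall_eq] at hv ⊢
    obtain ⟨m0, m1, m2, m3⟩ := hv
    have lin := lin_mem_idealI m0 m1 m2 m3
    refine ⟨?_, ?_, ?_, ?_⟩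
    · convert lin (lam * A0 + lam / α * A1 - 2 * (A0 + A1)) 0 (2 * (α - 1) * (u + A2))
        (2 * (α - 1) * (v + A3)) using 1
      simp [strOp_apply, leib, zv_vals, mul_add, mul_sub]
      simp only [hm]
      module
    · convert lin 0 (lam * A0 + lam / α * A1 - 4 * A1) (2 * (u - A2)) (2 * (v - A3)) using 1
      simp [strOp_apply, leib, zv_vals, mul_add, mul_sub]
      simp only [hm]
      module
    · convert lin (A3 - v) (2 * α * (A3 + v)) (lam * A0 + lam / α * A1 + p - (A0 + A1) - 2 * A1) r
        using 1
      simp [strOp_apply, leib, zv_vals, mul_add, mul_sub]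
      simp only [hm]
      module
    · convert lin (u - A2) (-(2 * α * (A2 + u))) q
        (lam * A0 + lam / α * A1 - p - (A0 + A1) - 2 * A1) using 1
      simp [strOp_apply, leib, zv_vals, mul_add, mul_sub]
      simp only [hm]
      module
  · simp only [vGen, if_neg hc, Set.mem_insert_iff, Set.mem_singleton_iff, forall_eq_or_imp,
      forall_eq] at hv ⊢
    obtain ⟨m0, m1, m2, m3⟩ := hv
    have lin := lin_mem_idealI m0 m1 m2 m3
    refine ⟨?_, ?_, ?_, ?_⟩
    · convert lin (lam * A0 + lam / α * A1 - 2 * (A0 + A1)) 0 (2 * (α - 1) * (u - A2))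
        (2 * (α - 1) * (v - A3)) using 1
      simp [strOp_apply, leib, zv_vals, mul_add, mul_sub]
      simp only [hm]
      module
    · convert lin 0 (lam * A0 + lam / α * A1 - 4 * A0) (-(2 * (u + A2))) (-(2 * (v + A3))) using 1
      simp [strOp_apply, leib, zv_vals, mul_add, mul_sub]
      simp only [hm]
      module
    · convert lin (A3 + v) (2 * (A3 - v)) (lam * A0 + lam / α * A1 + p - (A0 + A1) - 2 * A0) r
        using 1
      simp [strOp_apply, leib, zv_vals, mul_add, mul_sub]
      simp only [hm]
      module
    · convert lin (-(A2 + u)) (2 * (u - A2)) q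
        (lam * A0 + lam / α * A1 - p - (A0 + A1) - 2 * A0) using 1
      simp [strOp_apply, leib, zv_vals, mul_add, mul_sub]
      simp only [hm]
      module

lemma bessel_vGen {α lam : ℂ} (hs : Standing α lam) (x : JVec) :
    ∀ w ∈ vGen α lam, bessel α lam x w = 0 := by
  by_cases hc : lam = α
  · simp only [vGen, if_pos hc, Set.mem_insert_iff, Set.mem_singleton_iff, forall_eq_or_imp,
      forall_eq]
    have hl : α / α = 1 := div_self hs.ne_zero
    refine ⟨?_, ?_, ?_, ?_⟩ <;>
    · simp [bessel_apply, leib, zv_vals, mul_add, hc, hl]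
      first
        | done
        | module
        | exact Or.inr (by module)
  · simp only [vGen, if_neg hc, Set.mem_insert_iff, Set.mem_singleton_iff, forall_eq_or_imp,
      forall_eq]
    have hlam : lam = 1 := hs.eq_or.resolve_left hc
    have hne : α ≠ 0 := hs.ne_zero
    refine ⟨?_, ?_, ?_, ?_⟩ <;>
    · simp [bessel_apply, leib, zv_vals, mul_add, hlam, hne]
      first
        | done
        | module
        | exact Or.inr (by module)
        | match_scalars <;> field_simp <;> ring

lemma strOp_stable {α lam : ℂ} (A0 A1 A2 A3 u v p q r : ℂ) :
    ∀ w ∈ idealI α lam, strOp α lam A0 A1 A2 A3 u v p q r w ∈ idealI α lam := by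
  intro w hw
  rw [strOp_split]
  refine (idealI α lam).add_mem (idealI_stable _ (strOp_vGen _ _ _ _ _ _ _ _ _) ?_ w hw)
    (idealI_stable _ (strOp_vGen _ _ _ _ _ _ _ _ _) ?_ w hw)
  · intro i f hf hTf
    obtain ⟨g, hg⟩ := strOp_even_mul α lam A0 A1 p q r i f
    rw [hg]
    exact (idealI α lam).add_mem (mul_mem_idealI _ _ _ hTf) (mul_mem_idealI _ _ _ hf)
  · intro i f hf hTf
    obtain ⟨g, hg⟩ := strOp_odd_mul α lam A2 A3 u v i f
    rw [hg]
    exact (idealI α lam).add_mem (Submodule.smul_mem _ _ (mul_mem_idealI _ _ _ hTf)) (mul_mem_idealI _ _ _ hf)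

lemma bessel_stable_even {α lam : ℂ} (hs : Standing α lam) (x0 x1 : ℂ) :
    ∀ w ∈ idealI α lam, bessel α lam ![x0, x1, 0, 0] w ∈ idealI α lam := by
  have hz := bessel_vGen hs ![x0, x1, 0, 0]
  have hm := bessel_even_mul α lam x0 x1
  generalize bessel α lam ![x0, x1, 0, 0] = T at hz hm ⊢
  refine idealI_stable T (fun w hw => by rw [hz w hw]; exact zero_mem _) ?_
  intro i f hf hTf
  obtain ⟨A0, A1, A2, A3, u, v, p, q, r, h⟩ := hm i f
  rw [h]
  exact (idealI α lam).sub_mem (mul_mem_idealI _ _ _ hTf) (strOp_stable _ _ _ _ _ _ _ _ _ _ hf)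

lemma bessel_stable_odd {α lam : ℂ} (hs : Standing α lam) (x2 x3 : ℂ) :
    ∀ w ∈ idealI α lam, bessel α lam ![0, 0, x2, x3] w ∈ idealI α lam := by
  have hz := bessel_vGen hs ![0, 0, x2, x3]
  have hm := bessel_odd_mul α lam x2 x3
  generalize bessel α lam ![0, 0, x2, x3] = T at hz hm ⊢
  refine idealI_stable T (fun w hw => by rw [hz w hw]; exact zero_mem _) ?_
  intro i f hf hTf
  obtain ⟨A0, A1, A2, A3, u, v, p, q, r, h⟩ := hm i f
  rw [h]
  exact (idealI α lam).sub_mem (Submodule.smul_mem _ _ (mul_mem_idealI _ _ _ hTf))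
    (strOp_stable _ _ _ _ _ _ _ _ _ _ hf)

lemma bessel_split (α lam : ℂ) (x : JVec) : bessel α lam x =
    bessel α lam ![x 0, x 1, 0, 0] + bessel α lam ![0, 0, x 2, x 3] := by
  rw [← LinearMap.map_add]
  congr 1
  ext l; fin_cases l <;> simp

lemma bessel_stable {α lam : ℂ} (hs : Standing α lam) (x : JVec) :
    ∀ w ∈ idealI α lam, bessel α lam x w ∈ idealI α lam := by
  intro w hw
  rw [bessel_split, LinearMap.add_apply]
  exact (idealI α lam).add_mem (bessel_stable_even hs (x 0) (x 1) w hw)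
    (bessel_stable_odd hs (x 2) (x 3) w hw)

/-- `I_λ` is a submodule for `π_λ`. -/
lemma piRep_stable {α lam : ℂ} (hs : Standing α lam) (X : TKK α) :
    idealI α lam ≤ (idealI α lam).comap (piRep α lam X) := by
  intro w hw
  obtain ⟨A0, A1, A2, A3, u, v, p, q, r, h⟩ := pZero_eq_strOp α lam X.2.1.2
  have e : piRep α lam X w = (-2 * Complex.I) • (vecPoly X.1 * w)
      + strOp α lam A0 A1 A2 A3 u v p q r w - (Complex.I / 2) • bessel α lam X.2.2 w := by
    simp [piRep, h, mulVec_apply]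
  rw [Submodule.mem_comap, e]
  exact (idealI α lam).sub_mem ((idealI α lam).add_mem (Submodule.smul_mem _ _ (mul_mem_idealI _ _ _ hw))
    (strOp_stable _ _ _ _ _ _ _ _ _ _ hw)) (Submodule.smul_mem _ _ (bessel_stable hs _ _ hw))

/-! ## The Fock representation -/

/-- The quotient `𝒫(ℂ^{2|2}) / I_λ`. -/
abbrev Fock (α lam : ℂ) : Type := SPoly ⧸ idealI α lam

/-- The class of a superpolynomial modulo `I_λ`. -/
def cls (α lam : ℂ) : SPoly →ₗ[ℂ] Fock α lam := (idealI α lam).mkQ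

/-- The Fock representation `ρ_λ = π_λ ∘ c`, on the quotient `𝒫(ℂ^{2|2}) / I_λ`. -/
def rho {α lam : ℂ} (hs : Standing α lam) (X : TKK α) : Module.End ℂ (Fock α lam) :=
  (idealI α lam).mapQ (idealI α lam) (piRep α lam (cayley α X)) (piRep_stable hs (cayley α X))

/-- The Fock space `F_λ = U(𝔤) 1`: the image of the class of `1` under the associative algebra of
operators generated by `ρ_λ(𝔤)`. -/
def fockF {α lam : ℂ} (hs : Standing α lam) : Submodule ℂ (Fock α lam) :=
  (Subalgebra.toSubmodule (Algebra.adjoin ℂ (Set.range (rho hs)))).map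
    (LinearMap.applyₗ (cls α lam 1))

/-- The line `ℂ (z₁ + z₂)^k`. -/
def gComp (α lam : ℂ) (k : ℕ) : Submodule ℂ (Fock α lam) :=
  Submodule.span ℂ {cls α lam ((zv 0 + zv 1) ^ k)}

/-- `G_λ = ∑_{k ≥ 0} ℂ (z₁ + z₂)^k`. -/
def fockG (α lam : ℂ) : Submodule ℂ (Fock α lam) := ⨆ k, gComp α lam k

open scoped Classical in
/-- `hComp α lam k` is the component `H_{λ,k+1}` of degree `k + 1`, where, for `k ≥ 1`,
`H_{α,k} = (ℂ (z₁ + (k - 1 - α) z₂) ⊕ ℂ z₃ ⊕ ℂ z₄) z₁^{k-1}` and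
`H_{1,k} = (ℂ (z₂ + (k - 1 - α⁻¹) z₁) ⊕ ℂ z₃ ⊕ ℂ z₄) z₂^{k-1}`. -/
def hComp (α lam : ℂ) (k : ℕ) : Submodule ℂ (Fock α lam) :=
  if lam = α then
    Submodule.span ℂ {cls α lam ((zv 0 + ((k : ℂ) - α) • zv 1) * zv 0 ^ k),
      cls α lam (zv 2 * zv 0 ^ k), cls α lam (zv 3 * zv 0 ^ k)}
  else
    Submodule.span ℂ {cls α lam ((zv 1 + ((k : ℂ) - α⁻¹) • zv 0) * zv 1 ^ k),
      cls α lam (zv 2 * zv 1 ^ k), cls α lam (zv 3 * zv 1 ^ k)}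

/-- `H_λ = ∑_{k ≥ 1} H_{λ,k}`. -/
def fockH (α lam : ℂ) : Submodule ℂ (Fock α lam) := ⨆ k, hComp α lam k

end FockD21

end

noncomputable section

namespace FockD21

/-! ## The Cayley transform -/

/-! Write `μ = λ + λ/α`. Since `ρ = π ∘ c`, the transformed triple acts through the original one:
`ẽ` by `-(i/2)` times the Bessel operator of the unit, `f̃` by multiplication by `-2i(z₁ + z₂)`, and
`h̃` by `μ - 2E` with `E` the Euler operator. The algebra `𝔨₀` consists of derivations of `D_α`;
these kill the unit, hence commute with `e`, `f`, `h`. So `𝔨₀` commutes with `𝔰`, is fixed by `c`,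
and acts on superpolynomials by operators that commute with multiplication by `z₁ + z₂`.

The Bessel operator of the unit kills `1` and the three vectors `z₁ - αz₂`, `z₃`, `z₄`, which have
Euler degree `0` and `1`. Both spans are stable under derivations, so multiplying them by all powers
of `z₁ + z₂` gives subspaces invariant under `𝔰` and `𝔨₀` (`rho_sAlg_genSub`, `rho_k0_genSub`). The
relations of `I_λ` turn these products into the stated generators, so the subspaces are `G_λ` and
`H_λ` (`fockG_eq`, `hComp_eq`, `fockH_eq`). Different degrees are different eigenvalues of `h̃`,
which makes both sums direct.

The intersection vanishes because the Casimir operator of `𝔰`, suitably normalised, is `0` on `G_λ`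
and `μ = λ(1 + α)/α ≠ 0` on `H_λ` (`casimir_zs_pow`, `genSub_inf_eq_bot`). The sum is the whole
quotient: `z₁ + z₂`, `z₁ - αz₂`, `z₃`, `z₄` span the linear polynomials when `1 + α ≠ 0`, and modulo
`I_λ` a product of two of the last three is again `z₁ + z₂` times a linear polynomial
(`low_mul_low`), so `G_λ + H_λ` is stable under all multiplications (`genSub_sup_eq_top`). Finally
`F_λ` is also the whole quotient, since multiplication by any linear polynomial comes from an
element of `𝔤` (`fockF_eq_top`). -/

lemma expEquiv_apply {V : Type*} [AddCommGroup V] [Module ℂ V] (T : Module.End ℂ V)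
    (hT : IsNilpotent T) (h3 : T ^ 3 = 0) (x : V) :
    expEquiv V T hT x = x + T x + (1 / 2 : ℂ) • T (T x) := by
  -- The rational structure has to be the one chosen in `expEquiv`; a rational scalar then acts as
  -- its complex image by definition.
  let : Module ℚ (Module.End ℂ V) := Module.compHom _ (algebraMap ℚ ℂ)
  have e : expEquiv V T hT x = IsNilpotent.exp T x := rfl
  have hq : ∀ (r : ℚ) (A : Module.End ℂ V), r • A = (r : ℂ) • A := fun r A => rfl
  rw [e, IsNilpotent.exp_eq_sum h3]
  simp [Finset.sum_range_succ, hq, pow_succ]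

lemma ad_e_pow_three (α c : ℂ) : (c • tkkBracket α (eTri α)) ^ 3 = 0 :=
  LinearMap.ext fun X => by simp [pow_succ, ad_e, Prod.ext_iff]

lemma ad_f_pow_three (α c : ℂ) : (c • tkkBracket α (fTri α)) ^ 3 = 0 :=
  LinearMap.ext fun X => by simp [pow_succ, ad_f, Prod.ext_iff]

lemma ad_h (α : ℂ) (X : TKK α) : tkkBracket α (hTri α) X =
    ((-2 : ℂ) • X.1, 0, (2 : ℂ) • X.2.2) := by
  refine Prod.ext ?_ (Prod.ext (Subtype.ext ?_) ?_)
  · simp [tkkBracket, hTri, gZero, dualAct, jMul_unitJ_eq, sAct_apply, ← sub_smul, smul_smul]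
    norm_num
  · simp [tkkBracket, hTri, gZero, midBracket, jMul_unitJ_eq, ← sCommL_apply]
    simp [sCommL_apply, sComm_one_left]
  · simp [tkkBracket, hTri, gZero, jMul_unitJ_eq, sAct_apply]

lemma ad_e_hTri (α : ℂ) : tkkBracket α (eTri α) (hTri α) = (-2 : ℂ) • eTri α := by
  rw [ad_e]
  refine Prod.ext ?_ (Prod.ext (Subtype.ext ?_) ?_) <;>
    simp [hTri, eTri, gZero, gPlus, jMul_unitJ_eq]

lemma ad_e_fTri (α : ℂ) : tkkBracket α (eTri α) (fTri α) = hTri α := by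
  rw [ad_e]
  simp [hTri, fTri, gZero, gMinus]

lemma ad_e_eTri (α : ℂ) : tkkBracket α (eTri α) (eTri α) = 0 := by
  rw [ad_e]
  simp [eTri, gPlus, Prod.ext_iff]

lemma ad_f_hTri (α : ℂ) : tkkBracket α (fTri α) (hTri α) = (2 : ℂ) • fTri α := by
  rw [ad_f]
  simp [hTri, fTri, gZero, gMinus, jMul_unitJ_eq]

lemma ad_f_eTri (α : ℂ) : tkkBracket α (fTri α) (eTri α) = (-1 : ℂ) • hTri α := by
  rw [ad_f]
  refine Prod.ext ?_ (Prod.ext (Subtype.ext ?_) ?_)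
  · simp [hTri, eTri, gZero, gPlus]
  · change (-2 : ℂ) • jMul α unitJ = (-1 : ℂ) • (2 : ℂ) • jMul α unitJ
    rw [smul_smul]
    congr 1
    norm_num
  · simp [hTri, gZero]

lemma ad_f_fTri (α : ℂ) : tkkBracket α (fTri α) (fTri α) = 0 := by
  rw [ad_f]
  simp [fTri, gMinus, Prod.ext_iff]

/-- The inverse of `exp T ∘ exp S` on a triple on which `S` and `T` act like `i ad e` and
`(i/2) ad f`. -/
lemma exp_trans_symm_triple {V : Type*} [AddCommGroup V] [Module ℂ V] {S T : Module.End ℂ V}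
    (hS : IsNilpotent S) (hT : IsNilpotent T) (hS3 : S ^ 3 = 0) (hT3 : T ^ 3 = 0) {e f h : V}
    (Se : S e = 0) (Sh : S h = (-2 * Complex.I) • e) (Sf : S f = Complex.I • h)
    (Te : T e = (-(Complex.I / 2)) • h) (Th : T h = Complex.I • f) (Tf : T f = 0) :
    ((expEquiv V S hS).trans (expEquiv V T hT)).symm f = e + (-Complex.I) • h + f ∧
    ((expEquiv V S hS).trans (expEquiv V T hT)).symm h = Complex.I • e + (-Complex.I) • f ∧
    ((expEquiv V S hS).trans (expEquiv V T hT)).symm e =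
      (1 / 4 : ℂ) • e + (Complex.I / 4) • h + (1 / 4 : ℂ) • f := by
  have I2 := Complex.I_mul_I
  refine ⟨?_, ?_, ?_⟩
  · rw [LinearEquiv.symm_apply_eq, LinearEquiv.trans_apply]
    -- The claimed preimage is checked by applying the two exponentials forwards; `hy` is the value
    -- after the first. The same pattern serves `h` and `e`.
    have hy : expEquiv V S hS (e + (-Complex.I) • h + f) = f := by
      rw [expEquiv_apply _ _ hS3]
      simp only [map_add, map_smul, map_zero, smul_zero, Se, Sh, Sf]
      match_scalars <;> first | ring1 | linear_combination I2
    rw [hy, expEquiv_apply _ _ hT3]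
    simp [Tf]
  · rw [LinearEquiv.symm_apply_eq, LinearEquiv.trans_apply]
    have hy : expEquiv V S hS (Complex.I • e + (-Complex.I) • f) = h + (-Complex.I) • f := by
      rw [expEquiv_apply _ _ hS3]
      simp only [map_add, map_smul, map_zero, smul_zero, Se, Sh, Sf]
      match_scalars <;> first
        | ring1
        | linear_combination -I2
        | linear_combination Complex.I * I2
    rw [hy, expEquiv_apply _ _ hT3]
    simp only [map_add, map_smul, map_zero, smul_zero, Tf, Th]
    match_scalars <;> ring
  · rw [LinearEquiv.symm_apply_eq, LinearEquiv.trans_apply]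
    have hy : expEquiv V S hS ((1 / 4 : ℂ) • e + (Complex.I / 4) • h + (1 / 4 : ℂ) • f) =
        e + (Complex.I / 2) • h + (1 / 4 : ℂ) • f := by
      rw [expEquiv_apply _ _ hS3]
      simp only [map_add, map_smul, map_zero, smul_zero, Se, Sh, Sf]
      match_scalars <;> first | ring1 | linear_combination (-3 / 4) * I2
    rw [hy, expEquiv_apply _ _ hT3]
    simp only [map_add, map_smul, map_zero, smul_zero, Tf, Th, Te]
    match_scalars <;> first | ring1 | linear_combination (-1 / 4) * I2

/-- The three relations follow by expanding the explicit coordinates of the transformed triple, so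
it is not necessary to know that `c` preserves brackets. An abstract `br` reduces everything to
scalar identities with `i² = -1`. -/
lemma cayley_triple_brackets {V : Type*} [AddCommGroup V] [Module ℂ V]
    {br : V →ₗ[ℂ] V →ₗ[ℂ] V} {e f h : V}
    (ee : br e e = 0) (eh : br e h = (-2 : ℂ) • e) (ef : br e f = h)
    (fe : br f e = (-1 : ℂ) • h) (fh : br f h = (2 : ℂ) • f) (ff : br f f = 0)
    (he : br h e = (2 : ℂ) • e) (hf : br h f = (-2 : ℂ) • f) (hh : br h h = 0) {e' f' h' : V}
    (e1 : e' = (1 / 4 : ℂ) • e + (Complex.I / 4) • h + (1 / 4 : ℂ) • f)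
    (f1 : f' = e + (-Complex.I) • h + f) (h1 : h' = Complex.I • e + (-Complex.I) • f) :
    br h' e' = (2 : ℂ) • e' ∧ br h' f' = (-2 : ℂ) • f' ∧ br e' f' = h' := by
  have I2 := Complex.I_mul_I
  simp only [e1, f1, h1, map_add, map_smul, LinearMap.add_apply, LinearMap.smul_apply, ee, eh, ef,
    fe, fh, ff, he, hf, hh]
  refine ⟨?_, ?_, ?_⟩
  · match_scalars
    · ring
    · linear_combination (-1 / 2) * I2
    · linear_combination (-1 / 2) * I2
  · match_scalars
    · ring
    · linear_combination 2 * I2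
    · linear_combination 2 * I2
  · match_scalars <;> ring

lemma cayley_symm_triple (α : ℂ) :
    fTil α = eTri α + (-Complex.I) • hTri α + fTri α ∧
    hTil α = Complex.I • eTri α + (-Complex.I) • fTri α ∧
    eTil α = (1 / 4 : ℂ) • eTri α + (Complex.I / 4) • hTri α + (1 / 4 : ℂ) • fTri α :=
  exp_trans_symm_triple (V := TKK α) _ _ (ad_e_pow_three α _) (ad_f_pow_three α _)
    (by rw [LinearMap.smul_apply, ad_e_eTri, smul_zero])
    (by rw [LinearMap.smul_apply, ad_e_hTri, smul_smul, mul_comm])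
    (by rw [LinearMap.smul_apply, ad_e_fTri])
    (by rw [LinearMap.smul_apply, ad_f_eTri, smul_smul, mul_neg_one])
    (by rw [LinearMap.smul_apply, ad_f_hTri, smul_smul, div_mul_cancel₀ _ two_ne_zero])
    (by rw [LinearMap.smul_apply, ad_f_fTri, smul_zero])

lemma ad_h_eTri (α : ℂ) : tkkBracket α (hTri α) (eTri α) = (2 : ℂ) • eTri α := by
  rw [ad_h]
  simp [eTri, gPlus]

lemma ad_h_fTri (α : ℂ) : tkkBracket α (hTri α) (fTri α) = (-2 : ℂ) • fTri α := by
  rw [ad_h]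
  simp [fTri, gMinus]

lemma ad_h_hTri (α : ℂ) : tkkBracket α (hTri α) (hTri α) = 0 := by
  rw [ad_h]
  simp [hTri, gZero, Prod.ext_iff]

lemma sl2_triple (α : ℂ) :
    tkkBracket α (hTil α) (eTil α) = (2 : ℂ) • eTil α ∧
      tkkBracket α (hTil α) (fTil α) = (-2 : ℂ) • fTil α ∧
      tkkBracket α (eTil α) (fTil α) = hTil α :=
  have t := cayley_symm_triple α
  cayley_triple_brackets (V := TKK α) (br := tkkBracket α) (ad_e_eTri α) (ad_e_hTri α) (ad_e_fTri α) (ad_f_eTri α) (ad_f_hTri α)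
    (ad_f_fTri α) (ad_h_eTri α) (ad_h_fTri α) (ad_h_hTri α) t.2.2 t.1 t.2.1

/-- The elements of `𝔨₀` are the derivations. -/
lemma mem_k0_iff (α : ℂ) (Y : TKK α) :
    Y ∈ k0 α ↔ ∃ T : str α, Y = gZero α T ∧ (T : Module.End ℂ JVec) unitJ = 0 := by
  have hb : ∀ T : str α, tkkBracket α (gZero α T) (eTri α) =
      gPlus α ((T : Module.End ℂ JVec) unitJ) := by
    intro T
    refine Prod.ext ?_ (Prod.ext (Subtype.ext ?_) ?_)
    · simp [tkkBracket, gZero, eTri, gPlus, sAct, dualAct]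
    · simp [tkkBracket, gZero, eTri, gPlus, midBracket, ← sCommL_apply]
    · simp [tkkBracket, gZero, eTri, gPlus, sAct]
  constructor
  · rintro ⟨⟨T, rfl⟩, h⟩
    refine ⟨T, rfl, ?_⟩
    rw [hb] at h
    exact congrArg (fun Z : TKK α => Z.2.2) h
  · rintro ⟨T, rfl, h⟩
    refine ⟨⟨T, rfl⟩, ?_⟩
    rw [hb, h]
    rfl

/-- Bracketing `e` or `f` with an operator only sees its value on the unit, which is zero here, and
`h` is central in the middle component. -/
lemma ad_k0 {α : ℂ} {Y : TKK α} (hY : Y ∈ k0 α) : tkkBracket α (eTri α) Y = 0 ∧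
    tkkBracket α (fTri α) Y = 0 ∧ tkkBracket α (hTri α) Y = 0 := by
  obtain ⟨T, rfl, h⟩ := (mem_k0_iff α Y).1 hY
  simp [ad_e, ad_f, ad_h, gZero, h, Prod.ext_iff]

lemma expEquiv_fixed {V : Type*} [AddCommGroup V] [Module ℂ V] {T : Module.End ℂ V}
    (hT : IsNilpotent T) (hT3 : T ^ 3 = 0) {x : V} (h : T x = 0) : expEquiv V T hT x = x := by
  rw [expEquiv_apply _ _ hT3]
  simp [h]

/-- Both exponents annihilate `Y`. Hence on `𝔨₀` the representation `ρ` is given by `π` itself. -/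
lemma cayley_k0 {α : ℂ} {Y : TKK α} (hY : Y ∈ k0 α) : cayley α Y = Y := by
  rw [cayley, LinearEquiv.trans_apply, expEquiv_fixed (V := TKK α) _ (ad_e_pow_three α _),
    expEquiv_fixed (V := TKK α) _ (ad_f_pow_three α _)]
  · rw [LinearMap.smul_apply, (ad_k0 hY).2.1, smul_zero]
  · rw [LinearMap.smul_apply, (ad_k0 hY).1, smul_zero]

lemma bracket_sAlg_k0 (α : ℂ) : ∀ X ∈ sAlg α, ∀ Y ∈ k0 α, tkkBracket α X Y = 0 := by
  intro X hX Y hY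
  obtain ⟨he, hf, hh⟩ := ad_k0 hY
  suffices sAlg α ≤ LinearMap.ker ((tkkBracket α).flip Y) from this hX
  refine Submodule.span_le.2 ?_
  obtain ⟨f1, h1, e1⟩ := cayley_symm_triple α
  rintro _ (rfl | rfl | rfl) <;>
    simp [f1, h1, e1, he, hf, hh]

/-! ## The operators of the polynomial realisation -/

/-- The unit `z₁ + z₂`. -/
def zs : SPoly := zv 0 + zv 1

/-- The even element `z₁ - α z₂`, which together with `z₃` and `z₄` spans the lowest component of
`H_λ`. -/
def zw (α : ℂ) : SPoly := zv 0 - α • zv 1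

/-- The Euler operator `∑ zᵢ ∂ᵢ`. -/
def euler : Module.End ℂ SPoly where
  toFun f := zv 0 * pd 0 f + zv 1 * pd 1 f + zv 2 * pd 2 f + zv 3 * pd 3 f
  map_add' f g := by simp only [map_add, mul_add]; abel
  map_smul' c f := by simp [mul_smul_comm]

lemma euler_apply (f : SPoly) :
    euler f = zv 0 * pd 0 f + zv 1 * pd 1 f + zv 2 * pd 2 f + zv 3 * pd 3 f := rfl

lemma zs_commute (f : SPoly) : Commute zs f := by
  unfold Commute SemiconjBy
  ext1 <;> simp [zs, zv] <;> ring

lemma euler_zs_mul (f : SPoly) : euler (zs * f) = zs * f + zs * euler f := by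
  -- Hiding the product behind an opaque `m` makes each monomial an atom, so only linear algebra is
  -- left for `module`. This device recurs below.
  obtain ⟨m, hm⟩ : ∃ m : SPoly → SPoly → SPoly, ∀ a b, a * b = m a b := ⟨_, fun _ _ => rfl⟩
  simp [euler_apply, zs, add_mul, leib, zv_swap, mul_add]
  simp only [hm]
  module

set_option maxHeartbeats 800000 in
-- The operator form of `[e, f] = h`: the commutator of the Bessel operator of the unit with
-- multiplication by `z₁ + z₂` is `2E - μ`.
lemma bessel_zs_mul (α lam : ℂ) (f : SPoly) : bessel α lam unitJ (zs * f) =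
    zs * bessel α lam unitJ f - (lam + lam / α) • f + (2 : ℂ) • euler f := by
  generalize hl : lam / α = l
  obtain ⟨m, hm⟩ : ∃ m : SPoly → SPoly → SPoly, ∀ a b, a * b = m a b := ⟨_, fun _ _ => rfl⟩
  simp [bessel_apply, unitJ, euler_apply, zs, add_mul, leib, zv_swap, mul_add, mul_sub, hl]
  simp only [hm]
  module

lemma euler_zs_pow_mul {t : SPoly} {d : ℂ} (ht : euler t = d • t) (k : ℕ) :
    euler (zs ^ k * t) = ((k : ℂ) + d) • (zs ^ k * t) := by
  induction k with
  | zero => simp [ht]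
  | succ k ih =>
    rw [pow_succ', mul_assoc, euler_zs_mul, ih, mul_smul_comm]
    push_cast
    module

/-- The standard `sl(2)` string over a lowest vector of degree `d`: moving the Bessel operator past
the powers of `z₁ + z₂` collects `2(j + d) - μ` for `j = 0, …, k`, whose sum is the coefficient. -/
lemma bessel_zs_pow_mul {α lam : ℂ} {t : SPoly} {d : ℂ} (ht : euler t = d • t)
    (hb : bessel α lam unitJ t = 0) (k : ℕ) :
    bessel α lam unitJ (zs ^ (k + 1) * t) =
      (((k : ℂ) + 1) * (k + 2 * d - (lam + lam / α))) • (zs ^ k * t) := by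
  induction k with
  | zero =>
    rw [zero_add, pow_one, bessel_zs_mul, hb, ht, pow_zero, one_mul, mul_zero]
    push_cast
    module
  | succ k ih =>
    rw [pow_succ', mul_assoc, bessel_zs_mul, ih, euler_zs_pow_mul ht, mul_smul_comm, ← mul_assoc,
      ← pow_succ']
    push_cast
    module

/-- The lowest vectors of `G_λ` and `H_λ` have Euler degree `0` and `1`, and are killed by
the Bessel operator of the unit. -/
lemma euler_low (α : ℂ) : euler 1 = (0 : ℂ) • 1 ∧ euler (zw α) = (1 : ℂ) • zw α ∧
    euler (zv 2) = (1 : ℂ) • zv 2 ∧ euler (zv 3) = (1 : ℂ) • zv 3 := by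
  simp [euler_apply, zw, zv_vals, sub_eq_add_neg]

lemma bessel_low {α : ℂ} (hα : α ≠ 0) (lam : ℂ) : bessel α lam unitJ 1 = 0 ∧
    bessel α lam unitJ (zw α) = 0 ∧ bessel α lam unitJ (zv 2) = 0 ∧
    bessel α lam unitJ (zv 3) = 0 := by
  refine ⟨?_, ?_, ?_, ?_⟩ <;> simp [bessel_apply, unitJ, zw, zv_vals]
  -- Only `z₁ - αz₂` needs an argument: its two first-order terms are `-λ` and `α · λ/α`, which
  -- cancel.
  rw [smul_smul, div_mul_cancel₀ _ hα]
  simp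

lemma vecPoly_unitJ : vecPoly unitJ = zs := by
  simp [vecPoly, unitJ, zs, Fin.sum_univ_four]

lemma piRep_eTri (α lam : ℂ) (f : SPoly) :
    piRep α lam (eTri α) f = (-(Complex.I / 2)) • bessel α lam unitJ f := by
  simp [piRep, eTri, gPlus]

lemma piRep_gMinus (α lam : ℂ) (u : JVec) (f : SPoly) :
    piRep α lam (gMinus α u) f = (-2 * Complex.I) • (vecPoly u * f) := by
  simp [piRep, gMinus, mulVec_apply]

/-- The element is twice the identity operator, so it acts on `D_α⁻` by `-2`, which produces `-2E`;
the character contributes the constant. -/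
lemma piRep_hTri (α lam : ℂ) (f : SPoly) :
    piRep α lam (hTri α) f = (lam + lam / α) • f - (2 : ℂ) • euler f := by
  have e := bas_eq
  have h : piRep α lam (hTri α) f = pZero α lam ((2 : ℂ) • jMul α unitJ) f := by
    simp [piRep, hTri, gZero]
  have hd : ∀ v, dualAct α ((2 : ℂ) • jMul α unitJ) v = (-2 : ℂ) • v := by
    intro v
    simp only [dualAct, jMul_unitJ_eq, map_smul, LinearMap.sub_apply, LinearMap.smul_apply,
      Module.End.one_apply]
    module
  have hc : chr α lam ((2 : ℂ) • jMul α unitJ) = lam + lam / α := by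
    simp only [chr, jMul_unitJ_eq, LinearMap.coe_mk, AddHom.coe_mk, LinearMap.smul_apply,
      Module.End.one_apply, Pi.smul_apply, smul_eq_mul]
    simp only [unitJ, Matrix.cons_val_zero, Matrix.cons_val_one]
    ring
  rw [h]
  simp only [pZero, LinearMap.coe_mk, AddHom.coe_mk, hc, hd]
  simp only [map_smul, Fin.sum_univ_four,
    LinearMap.add_apply, LinearMap.smul_apply, Module.End.one_apply, Module.End.mul_apply,
    Algebra.smul_mul_assoc, mulVec_apply, e, vecPoly_mul, euler_apply]
  simp
  obtain ⟨m, hm⟩ : ∃ m : SPoly → SPoly → SPoly, ∀ a b, a * b = m a b := ⟨_, fun _ _ => rfl⟩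
  simp only [hm]
  module

/-- The derivations of `D_α` act as derivations of superpolynomials. -/
def derOp (α u v p q r : ℂ) (f : SPoly) : SPoly :=
  (-u) • (zv 2 * pd 0 f) + (-v) • (zv 3 * pd 0 f) + u • (zv 2 * pd 1 f) + v • (zv 3 * pd 1 f)
    + (-2 * v) • (zv 0 * pd 2 f) + (2 * α * v) • (zv 1 * pd 2 f) + p • (zv 2 * pd 2 f)
    + r • (zv 3 * pd 2 f) + (2 * u) • (zv 0 * pd 3 f) + (-2 * α * u) • (zv 1 * pd 3 f)
    + q • (zv 2 * pd 3 f) + (-p) • (zv 3 * pd 3 f)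

lemma piRep_k0 {α : ℂ} {Y : TKK α} (hY : Y ∈ k0 α) (lam : ℂ) :
    ∃ u v p q r : ℂ, ∀ f, piRep α lam Y f = derOp α u v p q r f := by
  obtain ⟨T, rfl, hT⟩ := (mem_k0_iff α Y).1 hY
  obtain ⟨a, D, hD, hTD⟩ := (mem_str_iff α T).1 T.2
  obtain ⟨u, v, p, q, r, h⟩ := (mem_der_iff α D).1 hD
  have hu : D unitJ = 0 := by
    rw [h]; ext l; fin_cases l <;> simp [unitJ]
  have ha : a = 0 := by
    rw [hTD, LinearMap.add_apply, jMul_unitJ_right, hu, add_zero] at hT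
    exact hT
  have hTD' : (T : Module.End ℂ JVec) = D := by rw [hTD, ha, map_zero, zero_add]
  refine ⟨u, v, p, q, r, fun f => ?_⟩
  have e := bas_eq
  have h0 : piRep α lam (gZero α T) f = pZero α lam D f := by
    simp [piRep, gZero, hTD']
  have hd : ∀ w, dualAct α D w = D w := by
    intro w
    simp [dualAct, hu]
  rw [h0]
  simp [pZero, hd, chr, hu, Fin.sum_univ_four, e, h, mulVec_apply, vecPoly_mul, derOp]
  obtain ⟨m, hm⟩ : ∃ m : SPoly → SPoly → SPoly, ∀ a b, a * b = m a b := ⟨_, fun _ _ => rfl⟩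
  simp only [hm]
  module

/-- A derivation of `D_α` kills the unit, so the induced superderivation kills the even element `z₁
+ z₂`. -/
lemma derOp_zs_mul (α u v p q r : ℂ) (f : SPoly) :
    derOp α u v p q r (zs * f) = zs * derOp α u v p q r f := by
  obtain ⟨m, hm⟩ : ∃ m : SPoly → SPoly → SPoly, ∀ a b, a * b = m a b := ⟨_, fun _ _ => rfl⟩
  simp [derOp, zs, add_mul, leib, zv_swap, mul_add]
  simp only [hm]
  module

lemma derOp_zs_pow_mul (α u v p q r : ℂ) (k : ℕ) (f : SPoly) :
    derOp α u v p q r (zs ^ k * f) = zs ^ k * derOp α u v p q r f := by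
  induction k with
  | zero => simp
  | succ k ih => rw [pow_succ', mul_assoc, derOp_zs_mul, ih, mul_assoc]

lemma derOp_low (α u v p q r : ℂ) : derOp α u v p q r 1 = 0 ∧
    derOp α u v p q r (zw α) = (-(1 + α) * u) • zv 2 + (-(1 + α) * v) • zv 3 ∧
    derOp α u v p q r (zv 2) = (-2 * v) • zw α + p • zv 2 + r • zv 3 ∧
    derOp α u v p q r (zv 3) = (2 * u) • zw α + q • zv 2 + (-p) • zv 3 := by
  refine ⟨?_, ?_, ?_, ?_⟩ <;> simp [derOp, zw, zv_vals] <;> module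

/-! ## The Fock representation on classes -/

section Rho

variable {α lam : ℂ} (hs : Standing α lam)

lemma cls_surjective (α lam : ℂ) : Function.Surjective (cls α lam) :=
  Submodule.mkQ_surjective _

lemma cls_eq_cls {p q : SPoly} : cls α lam p = cls α lam q ↔ p - q ∈ idealI α lam :=
  Submodule.Quotient.eq _

lemma rho_cls (X : TKK α) (p : SPoly) :
    rho hs X (cls α lam p) = cls α lam (piRep α lam (cayley α X) p) := by
  rw [rho, cls, Submodule.mkQ_apply, Submodule.mapQ_apply, Submodule.mkQ_apply]

lemma rho_add (X Y : TKK α) : rho hs (X + Y) = rho hs X + rho hs Y := by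
  refine LinearMap.ext fun x => ?_
  obtain ⟨p, rfl⟩ := cls_surjective α lam x
  simp [rho_cls]

lemma rho_smul (c : ℂ) (X : TKK α) : rho hs (c • X) = c • rho hs X := by
  refine LinearMap.ext fun x => ?_
  obtain ⟨p, rfl⟩ := cls_surjective α lam x
  simp [rho_cls]

/-- The transform `c` in `ρ` cancels the `c⁻¹` defining `ẽ`; the same holds for `f̃`, `h̃` and every
element of `c⁻¹(D_α⁻)`. -/
lemma rho_eTil (p : SPoly) : rho hs (eTil α) (cls α lam p) =
    (-(Complex.I / 2)) • cls α lam (bessel α lam unitJ p) := by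
  rw [rho_cls, eTil, LinearEquiv.apply_symm_apply, piRep_eTri, map_smul]

/-- This realises multiplication by an arbitrary linear superpolynomial inside the image of `𝔤`, up
to the nonzero factor `-2i`. -/
lemma rho_gMinus (u : JVec) (p : SPoly) : rho hs ((cayley α).symm (gMinus α u)) (cls α lam p) =
    (-2 * Complex.I) • cls α lam (vecPoly u * p) := by
  rw [rho_cls, LinearEquiv.apply_symm_apply, piRep_gMinus, map_smul]

lemma rho_fTil (p : SPoly) : rho hs (fTil α) (cls α lam p) =
    (-2 * Complex.I) • cls α lam (zs * p) := by
  rw [fTil, fTri, rho_gMinus, vecPoly_unitJ]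

lemma rho_hTil (p : SPoly) : rho hs (hTil α) (cls α lam p) =
    (lam + lam / α) • cls α lam p - (2 : ℂ) • cls α lam (euler p) := by
  rw [rho_cls, hTil, LinearEquiv.apply_symm_apply, piRep_hTri, map_sub, map_smul, map_smul]

lemma rho_hTil_zs_pow {t : SPoly} {d : ℂ} (ht : euler t = d • t) (k : ℕ) :
    rho hs (hTil α) (cls α lam (zs ^ k * t)) =
      ((lam + lam / α) - 2 * (k + d)) • cls α lam (zs ^ k * t) := by
  rw [rho_hTil, euler_zs_pow_mul ht, map_smul]
  module

/-- The Casimir operator of `𝔰`, normalised to vanish on the class of `1`. -/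
def casimir : Module.End ℂ (Fock α lam) :=
  -(rho hs (fTil α) * rho hs (eTil α))
    - ((1 / 2 : ℂ) • ((lam + lam / α) • 1 - rho hs (hTil α))) *
      ((1 / 2 : ℂ) • ((lam + lam / α) • 1 - rho hs (hTil α)) - (1 + (lam + lam / α)) • 1)

/-- With Euler degree `k + d`, the operator equals `k(k - 1 + 2d - μ) - (k + d)(k + d - 1 - μ)`. All
terms in `k` cancel, so the eigenvalue depends on the lowest vector alone. -/
lemma casimir_zs_pow {t : SPoly} {d : ℂ} (ht : euler t = d • t)
    (hb : bessel α lam unitJ t = 0) (k : ℕ) :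
    casimir hs (cls α lam (zs ^ k * t)) =
      (d * (1 + (lam + lam / α)) - d ^ 2) • cls α lam (zs ^ k * t) := by
  have hI : (-2 * Complex.I) * (-(Complex.I / 2)) = -1 := by
    linear_combination Complex.I_mul_I
  have hfe : rho hs (fTil α) (rho hs (eTil α) (cls α lam (zs ^ k * t))) =
      (-((k : ℂ) * (k - 1 + 2 * d - (lam + lam / α)))) • cls α lam (zs ^ k * t) := by
    rw [rho_eTil, map_smul, rho_fTil, smul_comm, smul_smul, hI]
    cases k with
    | zero => simp [hb]
    | succ k =>
      rw [bessel_zs_pow_mul ht hb, mul_smul_comm, map_smul, ← mul_assoc, ← pow_succ', smul_smul]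
      push_cast
      module
  simp only [casimir, LinearMap.sub_apply, LinearMap.neg_apply, Module.End.mul_apply, hfe,
    LinearMap.smul_apply, Module.End.one_apply, map_smul, map_sub, rho_hTil_zs_pow hs ht]
  module

end Rho

/-! ## Submodules generated by lowest vectors -/

section Gen

variable {α lam : ℂ}

/-- The span of the classes of all `(z₁ + z₂)^k t` with `t ∈ S`. -/
def genSub (α lam : ℂ) (S : Set SPoly) : Submodule ℂ (Fock α lam) :=
  Submodule.span ℂ {x | ∃ k : ℕ, ∃ t ∈ S, x = cls α lam (zs ^ k * t)}

lemma cls_mem_genSub {S : Set SPoly} (k : ℕ) {t : SPoly} (ht : t ∈ Submodule.span ℂ S) :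
    cls α lam (zs ^ k * t) ∈ genSub α lam S := by
  induction ht using Submodule.span_induction with
  | mem x hx => exact Submodule.subset_span ⟨k, x, hx, rfl⟩
  | zero => simp
  | add x y _ _ hx hy => rw [mul_add, map_add]; exact add_mem hx hy
  | smul c x _ hx => rw [mul_smul_comm, map_smul]; exact Submodule.smul_mem _ _ hx

lemma genSub_le_iff {S : Set SPoly} {P : Submodule ℂ (Fock α lam)} :
    genSub α lam S ≤ P ↔ ∀ k : ℕ, ∀ t ∈ S, cls α lam (zs ^ k * t) ∈ P := by
  rw [genSub, Submodule.span_le]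
  exact ⟨fun h k t ht => h ⟨k, t, ht, rfl⟩, by rintro h _ ⟨k, t, ht, rfl⟩; exact h k t ht⟩

/-- On `(z₁ + z₂)^k t` the operator of `ẽ` lowers `k` and gives zero at `k = 0`, that of `f̃` raises
`k`, and that of `h̃` is a scalar. Linearity of `ρ` covers their span. -/
lemma rho_sAlg_genSub (hs : Standing α lam) {S : Set SPoly} {d : ℂ}
    (hE : ∀ t ∈ S, euler t = d • t) (hB : ∀ t ∈ S, bessel α lam unitJ t = 0) {X : TKK α}
    (hX : X ∈ sAlg α) : genSub α lam S ≤ (genSub α lam S).comap (rho hs X) := by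
  have hm : ∀ k : ℕ, ∀ t ∈ S, cls α lam (zs ^ k * t) ∈ genSub α lam S := genSub_le_iff.1 le_rfl
  induction hX using Submodule.span_induction with
  | mem X hX =>
    refine genSub_le_iff.2 fun k t ht => ?_
    rw [Submodule.mem_comap]
    obtain rfl | rfl | rfl := hX
    · rw [rho_eTil]
      refine Submodule.smul_mem _ _ ?_
      cases k with
      | zero => simp [hB t ht]
      | succ k =>
        rw [bessel_zs_pow_mul (hE t ht) (hB t ht), map_smul]
        exact Submodule.smul_mem _ _ (hm k t ht)
    · rw [rho_fTil, ← mul_assoc, ← pow_succ']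
      exact Submodule.smul_mem _ _ (hm _ t ht)
    · rw [rho_hTil_zs_pow hs (hE t ht)]
      exact Submodule.smul_mem _ _ (hm _ t ht)
  | zero =>
    intro x hx
    have h0 : rho hs 0 = 0 := by simpa using rho_smul hs 0 (0 : TKK α)
    rw [Submodule.mem_comap, h0]
    exact zero_mem _
  | add X Y _ _ hX hY =>
    intro x hx
    rw [Submodule.mem_comap, rho_add]
    exact add_mem (hX hx) (hY hx)
  | smul c X _ hX =>
    intro x hx
    rw [Submodule.mem_comap, rho_smul]
    exact Submodule.smul_mem _ _ (hX hx)

/-- Since `𝔨₀` commutes with multiplication by `z₁ + z₂`, stability need only be known on the lowest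
vectors. -/
lemma rho_k0_genSub (hs : Standing α lam) {S : Set SPoly}
    (hD : ∀ u v p q r : ℂ, ∀ t ∈ S, derOp α u v p q r t ∈ Submodule.span ℂ S) {X : TKK α}
    (hX : X ∈ k0 α) : genSub α lam S ≤ (genSub α lam S).comap (rho hs X) := by
  obtain ⟨u, v, p, q, r, h⟩ := piRep_k0 hX lam
  refine genSub_le_iff.2 fun k t ht => ?_
  rw [Submodule.mem_comap, rho_cls, cayley_k0 hX, h, derOp_zs_pow_mul]
  exact cls_mem_genSub k (hD u v p q r t ht)

/-- The basis of the lowest component of `H_λ`. -/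
def lowH (α : ℂ) : Set SPoly := {zw α, zv 2, zv 3}

lemma forall_lowH {P : SPoly → Prop} :
    (∀ t ∈ lowH α, P t) ↔ P (zw α) ∧ P (zv 2) ∧ P (zv 3) := by
  simp [lowH]

lemma euler_lowH : ∀ t ∈ lowH α, euler t = (1 : ℂ) • t := by
  obtain ⟨-, h1, h2, h3⟩ := euler_low α
  exact forall_lowH.2 ⟨h1, h2, h3⟩

lemma bessel_lowH (hα : α ≠ 0) (lam : ℂ) : ∀ t ∈ lowH α, bessel α lam unitJ t = 0 := by
  obtain ⟨-, h1, h2, h3⟩ := bessel_low hα lam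
  exact forall_lowH.2 ⟨h1, h2, h3⟩

lemma derOp_lowH (u v p q r : ℂ) :
    ∀ t ∈ lowH α, derOp α u v p q r t ∈ Submodule.span ℂ (lowH α) := by
  have m1 : zw α ∈ Submodule.span ℂ (lowH α) := Submodule.subset_span (by simp [lowH])
  have m2 : zv 2 ∈ Submodule.span ℂ (lowH α) := Submodule.subset_span (by simp [lowH])
  have m3 : zv 3 ∈ Submodule.span ℂ (lowH α) := Submodule.subset_span (by simp [lowH])
  obtain ⟨-, h1, h2, h3⟩ := derOp_low α u v p q r
  refine forall_lowH.2 ⟨?_, ?_, ?_⟩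
  · rw [h1]
    exact add_mem (Submodule.smul_mem _ _ m2) (Submodule.smul_mem _ _ m3)
  · rw [h2]
    exact add_mem (add_mem (Submodule.smul_mem _ _ m1) (Submodule.smul_mem _ _ m2))
      (Submodule.smul_mem _ _ m3)
  · rw [h3]
    exact add_mem (add_mem (Submodule.smul_mem _ _ m1) (Submodule.smul_mem _ _ m2))
      (Submodule.smul_mem _ _ m3)

/-! ### Identification of the components of `G_λ` and `H_λ` -/

lemma gComp_eq (α lam : ℂ) (k : ℕ) :
    gComp α lam k = Submodule.span ℂ {cls α lam (zs ^ k * 1)} := by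
  rw [mul_one]; rfl

lemma zv_commute (i : Fin 2) (f : SPoly) : Commute (zv (Fin.castLE (by norm_num) i)) f := by
  unfold Commute SemiconjBy
  fin_cases i <;> ext1 <;> simp [zv] <;> ring

lemma cls_mul_left {p q : SPoly} (h : cls α lam p = cls α lam q) (f : SPoly) :
    cls α lam (f * p) = cls α lam (f * q) := by
  rw [cls_eq_cls] at h ⊢
  rw [← mul_sub]
  exact mul_mem_idealI _ _ _ h

/-- If `n` kills `x` modulo the ideal, each factor `z₁ + z₂ = m + n` acts on `x` as `m`. It is
applied to `x = z₃, z₄`, with `m = z₁` when `λ = α` and `m = z₂` when `λ = 1`. -/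
lemma cls_zs_pow_mul {m n x : SPoly} (hm : ∀ f, Commute m f) (hmn : zs = m + n)
    (hx : n * x ∈ idealI α lam) (k : ℕ) :
    cls α lam (zs ^ k * x) = cls α lam (x * m ^ k) := by
  induction k with
  | zero => simp
  | succ k ih =>
    rw [pow_succ', mul_assoc, cls_mul_left ih, cls_eq_cls]
    have e : zs * (x * m ^ k) - x * m ^ (k + 1) = m ^ k * (n * x) := by
      rw [((hm (n * x)).pow_left k).eq, hmn, add_mul, pow_succ', ← mul_assoc m, (hm x).eq]
      simp only [mul_assoc]
      abel
    rw [e]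
    exact mul_mem_idealI _ _ _ hx

/-- Modulo `n²` one has `(m + n)(m + an) = m² + (a + 1)mn`, so every factor `z₁ + z₂` raises the
coefficient of `n` by one. This is the source of the shifts `k - 1 - α` and `k - 1 - α⁻¹` in the
definition of `H_λ`. -/
lemma cls_zs_pow_mul_sub {m n : SPoly} (hm : ∀ f, Commute m f) (hmn : zs = m + n)
    (hn : n * n ∈ idealI α lam) (c : ℂ) (k : ℕ) :
    cls α lam (zs ^ k * (m - c • n)) = cls α lam ((m + ((k : ℂ) - c) • n) * m ^ k) := by
  induction k with
  | zero => congr 1; simp [sub_eq_add_neg]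
  | succ k ih =>
    rw [pow_succ', mul_assoc, cls_mul_left ih, cls_eq_cls]
    have e : zs * ((m + ((k : ℂ) - c) • n) * m ^ k)
        - (m + (((k + 1 : ℕ) : ℂ) - c) • n) * m ^ (k + 1) = ((k : ℂ) - c) • (m ^ k * (n * n)) := by
      have h1 : m * (n * m ^ k) = n * (m * m ^ k) := by
        rw [← mul_assoc, (hm n).eq, mul_assoc]
      rw [((hm (n * n)).pow_left k).eq, hmn, pow_succ']
      simp only [mul_assoc, add_mul, mul_add, smul_mul_assoc, mul_smul_comm, h1, smul_add]
      push_cast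
      generalize m * (m * m ^ k) = a1
      generalize n * (m * m ^ k) = a2
      generalize n * (n * m ^ k) = a3
      module
    rw [e]
    exact Submodule.smul_mem _ _ (mul_mem_idealI _ _ _ hn)

lemma hComp_eq (hs : Standing α lam) (k : ℕ) : hComp α lam k =
    Submodule.span ℂ {cls α lam (zs ^ k * zw α), cls α lam (zs ^ k * zv 2),
      cls α lam (zs ^ k * zv 3)} := by
  have hv := @mem_idealI_of_vGen α lam
  by_cases hc : lam = α
  · simp only [vGen, if_pos hc, Set.mem_insert_iff, Set.mem_singleton_iff, forall_eq_or_imp,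
      forall_eq] at hv
    rw [hComp, if_pos hc, cls_zs_pow_mul (zv_commute 0) rfl hv.2.2.1 k,
      cls_zs_pow_mul (zv_commute 0) rfl hv.2.2.2 k, zw]
    erw [cls_zs_pow_mul_sub (zv_commute 0) rfl hv.2.1 α k]
    rfl
  · simp only [vGen, if_neg hc, Set.mem_insert_iff, Set.mem_singleton_iff, forall_eq_or_imp,
      forall_eq] at hv
    have hz : zs = zv 1 + zv 0 := add_comm _ _
    -- For `λ = 1` the coordinates `z₁` and `z₂` exchange roles; the extra factor `-α` is invertible
    -- and does not change the span.
    have hw : zw α = (-α) • (zv 1 - α⁻¹ • zv 0) := by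
      rw [zw, smul_sub, smul_smul, neg_mul, mul_inv_cancel₀ hs.ne_zero]
      module
    have hu : IsUnit (-α) := (neg_ne_zero.2 hs.ne_zero).isUnit
    rw [hComp, if_neg hc, cls_zs_pow_mul (zv_commute 1) hz hv.2.2.1 k,
      cls_zs_pow_mul (zv_commute 1) hz hv.2.2.2 k, hw, mul_smul_comm, map_smul]
    erw [cls_zs_pow_mul_sub (zv_commute 1) hz hv.2.1 α⁻¹ k]
    rw [Submodule.span_insert, Submodule.span_insert (R := ℂ) ((-α) • _),
      Submodule.span_singleton_smul_eq hu]
    rfl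

lemma fockG_eq (α lam : ℂ) : fockG α lam = genSub α lam {1} := by
  refine le_antisymm (iSup_le fun k => ?_) (genSub_le_iff.2 ?_)
  · rw [gComp_eq, Submodule.span_singleton_le_iff_mem]
    exact cls_mem_genSub k (Submodule.subset_span rfl)
  · rintro k _ rfl
    refine Submodule.mem_iSup_of_mem k ?_
    rw [gComp_eq]
    exact Submodule.mem_span_singleton_self _

lemma fockH_eq (hs : Standing α lam) : fockH α lam = genSub α lam (lowH α) := by
  refine le_antisymm (iSup_le fun k => ?_) (genSub_le_iff.2 ?_)
  · rw [hComp_eq hs, Submodule.span_le]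
    rintro _ (rfl | rfl | rfl) <;>
      exact cls_mem_genSub k (Submodule.subset_span (by simp [lowH]))
  · intro k t ht
    refine Submodule.mem_iSup_of_mem k ?_
    rw [hComp_eq hs]
    obtain rfl | rfl | rfl := ht <;> exact Submodule.subset_span (by simp)

/-- The products of the lowest vectors modulo `I_λ`. -/
lemma low_mul_low (hs : Standing α lam) (hα : 1 + α ≠ 0) : ∃ a b c d e : ℂ,
    zw α * zv 2 - a • (zs * zv 2) ∈ idealI α lam ∧ zw α * zv 3 - a • (zs * zv 3) ∈ idealI α lam ∧
    zw α * zw α - (b • (zs * zs) + c • (zs * zw α)) ∈ idealI α lam ∧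
    zv 2 * zv 3 - (d • (zs * zs) + e • (zs * zw α)) ∈ idealI α lam := by
  have hv := @mem_idealI_of_vGen α lam
  obtain ⟨m, hm⟩ : ∃ m : SPoly → SPoly → SPoly, ∀ a b, a * b = m a b := ⟨_, fun _ _ => rfl⟩
  by_cases hc : lam = α
  · simp only [vGen, if_pos hc, Set.mem_insert_iff, Set.mem_singleton_iff, forall_eq_or_imp,
      forall_eq] at hv
    obtain ⟨m0, m1, m2, m3⟩ := hv
    have lin := lin_mem_idealI m0 m1 m2 m3
    -- Here `z₂` kills `z₂`, `z₃`, `z₄`, so `z₁ - αz₂` acts on `z₃`, `z₄` as `z₁ + z₂` does. The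
    -- last two witnesses come from `z₃z₄ = -2z₁z₂` and `(z₁ + z₂)² - (z₁ + z₂)(z₁ - αz₂) = (1 +
    -- α)z₁z₂`, both modulo the ideal.
    refine ⟨1, -1, 2, -2 / (1 + α), 2 / (1 + α), ?_, ?_, ?_, ?_⟩
    · convert lin 0 0 (-(1 + α)) 0 using 1
      simp only [zw, zs, add_mul, sub_mul, mul_add, mul_sub, smul_mul_assoc, mul_smul_comm, zv_vals]
      simp only [hm]
      module
    · convert lin 0 0 0 (-(1 + α)) using 1
      simp only [zw, zs, add_mul, sub_mul, mul_add, mul_sub, smul_mul_assoc, mul_smul_comm, zv_vals]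
      simp only [hm]
      module
    · convert lin 0 ((1 + α) ^ 2) 0 0 using 1
      simp only [zw, zs, add_mul, sub_mul, mul_add, mul_sub, smul_mul_assoc, mul_smul_comm, zv_vals]
      simp only [hm]
      module
    · convert lin 1 2 0 0 using 1
      simp only [zw, zs, add_mul, sub_mul, mul_add, mul_sub, smul_mul_assoc, mul_smul_comm, zv_vals]
      simp only [hm]
      match_scalars <;> field_simp <;> ring
  · simp only [vGen, if_neg hc, Set.mem_insert_iff, Set.mem_singleton_iff, forall_eq_or_imp,
      forall_eq] at hv
    obtain ⟨m0, m1, m2, m3⟩ := hv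
    have lin := lin_mem_idealI m0 m1 m2 m3
    -- Now `z₁` kills `z₁`, `z₃`, `z₄`, so `z₁ - αz₂` acts on `z₃`, `z₄` as `-α(z₁ + z₂)`. For the
    -- last product, `z₃z₄ = -2αz₁z₂` and `α(z₁ + z₂)² + (z₁ + z₂)(z₁ - αz₂) = (1 + α)z₁z₂` modulo
    -- the ideal.
    refine ⟨-α, -α ^ 2, -2 * α, -2 * α ^ 2 / (1 + α), -2 * α / (1 + α), ?_, ?_, ?_, ?_⟩
    · convert lin 0 0 (1 + α) 0 using 1
      simp only [zw, zs, add_mul, sub_mul, mul_add, mul_sub, smul_mul_assoc, mul_smul_comm, zv_vals]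
      simp only [hm]
      module
    · convert lin 0 0 0 (1 + α) using 1
      simp only [zw, zs, add_mul, sub_mul, mul_add, mul_sub, smul_mul_assoc, mul_smul_comm, zv_vals]
      simp only [hm]
      module
    · convert lin 0 ((1 + α) ^ 2) 0 0 using 1
      simp only [zw, zs, add_mul, sub_mul, mul_add, mul_sub, smul_mul_assoc, mul_smul_comm, zv_vals]
      simp only [hm]
      module
    · convert lin 1 (2 * α) 0 0 using 1
      simp only [zw, zs, add_mul, sub_mul, mul_add, mul_sub, smul_mul_assoc, mul_smul_comm, zv_vals]
      simp only [hm]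
      match_scalars <;> field_simp <;> ring

end Gen

/-! ### The decomposition of the Fock space -/

variable {α lam : ℂ}

lemma vecPoly_bas (i : Fin 4) : vecPoly (bas i) = zv i := by
  simp [vecPoly, bas, Pi.single_apply]

/-- A subspace of the Fock quotient that contains `1` and is stable under multiplication by
linear superpolynomials is everything. -/
lemma eq_top_of_vecPoly_mul (P : Submodule ℂ (Fock α lam)) (h1 : cls α lam 1 ∈ P)
    (h : ∀ i p, cls α lam p ∈ P → cls α lam (zv i * p) ∈ P) : P = ⊤ := by
  refine eq_top_iff.2 fun x _ => ?_
  obtain ⟨p, rfl⟩ := cls_surjective α lam x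
  have := mul_mem_of_zv_mul_mem (P.comap (cls α lam)) h p (q := 1) h1
  rwa [mul_one] at this

/-- Multiplication by each coordinate is a scalar multiple of some `ρ(X)`, so every class is reached
from that of `1`. -/
lemma fockF_eq_top (hs : Standing α lam) : fockF hs = ⊤ := by
  refine eq_top_of_vecPoly_mul _ ⟨1, Subalgebra.one_mem _, rfl⟩ ?_
  rintro i p ⟨A, hA, hAp⟩
  have hne : -2 * Complex.I ≠ 0 := by simp
  refine ⟨(-2 * Complex.I)⁻¹ • (rho hs ((cayley α).symm (gMinus α (bas i))) * A), ?_, ?_⟩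
  · exact Subalgebra.smul_mem _ (Subalgebra.mul_mem _
      (Algebra.subset_adjoin (Set.mem_range_self ((cayley α).symm (gMinus α (bas i))))) hA) _
  · rw [LinearMap.applyₗ_apply_apply] at hAp ⊢
    rw [LinearMap.smul_apply, Module.End.mul_apply, hAp, rho_gMinus, vecPoly_bas, smul_smul,
      inv_mul_cancel₀ hne, one_smul]

/-- The passage from `z₁, z₂` to `z₁ + z₂, z₁ - αz₂` has determinant `-(1 + α)`. -/
lemma zv_mem_span_low (hα : 1 + α ≠ 0) (i : Fin 4) :
    ∃ a b c d : ℂ, zv i = a • zs + b • zw α + c • zv 2 + d • zv 3 := by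
  refine ⟨![α / (1 + α), 1 / (1 + α), 0, 0] i, ![1 / (1 + α), -1 / (1 + α), 0, 0] i,
    ![0, 0, 1, 0] i, ![0, 0, 0, 1] i, ?_⟩
  fin_cases i <;> simp [zs, zw] <;> match_scalars <;> field_simp <;> ring

/-- Expand `zᵢ` in the basis adapted to `G_λ` and `H_λ`. A factor `z₁ + z₂` only raises the power,
and products of two lowest vectors of degree one reduce by `low_mul_low`, the antisymmetry of `z₃z₄`
and the vanishing of odd squares. -/
lemma zs_pow_mul_zv_mul_mem (hs : Standing α lam) (hα : 1 + α ≠ 0) (i : Fin 4) (k : ℕ) {t : SPoly}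
    (ht : t = 1 ∨ t ∈ lowH α) :
    cls α lam (zs ^ k * (zv i * t)) ∈ genSub α lam {1} ⊔ genSub α lam (lowH α) := by
  set P := genSub α lam {1} ⊔ genSub α lam (lowH α) with hP
  have hg : ∀ k : ℕ, cls α lam (zs ^ k * 1) ∈ P := fun k =>
    Submodule.mem_sup_left (cls_mem_genSub k (Submodule.subset_span rfl))
  have hl : ∀ k : ℕ, ∀ t ∈ lowH α, cls α lam (zs ^ k * t) ∈ P := fun k t ht =>
    Submodule.mem_sup_right (cls_mem_genSub k (Submodule.subset_span ht))
  have h2 : ∀ k : ℕ, cls α lam (zs ^ k * zw α) ∈ P ∧ cls α lam (zs ^ k * zv 2) ∈ P ∧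
      cls α lam (zs ^ k * zv 3) ∈ P := fun k => forall_lowH.1 (hl k)
  have hzs : ∀ (k : ℕ) (f : SPoly), zs ^ k * (zs * f) = zs ^ (k + 1) * f := fun k f => by
    rw [← mul_assoc, ← pow_succ]
  have hz2 : ∀ k : ℕ, zs ^ k * (zs * zs) = zs ^ (k + 2) * 1 := fun k => by
    rw [mul_one, pow_add, pow_two]
  have hmod : ∀ {p q : SPoly}, p - q ∈ idealI α lam → cls α lam (zs ^ k * q) ∈ P →
      cls α lam (zs ^ k * p) ∈ P := fun h h' => by
    rw [cls_mul_left (cls_eq_cls.2 h)]; exact h'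
  obtain ⟨a, b, c, d, e, e1, e2, e3, e4⟩ := low_mul_low hs hα
  have lin : ∀ (x y : SPoly) (a b : ℂ), cls α lam (zs ^ k * x) ∈ P → cls α lam (zs ^ k * y) ∈ P →
      cls α lam (zs ^ k * (a • x + b • y)) ∈ P := fun x y a b hx hy => by
    rw [mul_add, mul_smul_comm, mul_smul_comm, map_add, map_smul, map_smul]
    exact add_mem (Submodule.smul_mem _ _ hx) (Submodule.smul_mem _ _ hy)
  have hss : cls α lam (zs ^ k * (zs * zs)) ∈ P := by rw [hz2]; exact hg _
  have hst : ∀ t ∈ lowH α, cls α lam (zs ^ k * (zs * t)) ∈ P := fun t ht => by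
    rw [hzs]; exact hl _ _ ht
  obtain ⟨hsw, hs2, hs3⟩ := forall_lowH.1 hst
  have sm : ∀ (x : SPoly) (a : ℂ), cls α lam (zs ^ k * x) ∈ P →
      cls α lam (zs ^ k * (a • x)) ∈ P := fun x a hx => by
    rw [mul_smul_comm, map_smul]; exact Submodule.smul_mem _ _ hx
  have w2 := hmod e1 (sm _ a hs2)
  have w3 := hmod e2 (sm _ a hs3)
  have ww := hmod e3 (lin _ _ b c hss hsw)
  have h23 := hmod e4 (lin _ _ d e hss hsw)
  have c2 : zv 2 * zw α = zw α * zv 2 := by ext1 <;> simp [zw, zv]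
  have c3 : zv 3 * zw α = zw α * zv 3 := by ext1 <;> simp [zw, zv]
  have h32 : cls α lam (zs ^ k * (zv 3 * zv 2)) ∈ P := by
    rw [zv_three_two, mul_neg, map_neg]
    exact neg_mem h23
  have h0 : cls α lam (zs ^ k * 0) ∈ P := by simp
  obtain ⟨y0, y1, y2, y3, hy⟩ := zv_mem_span_low hα i
  have key : cls α lam (zs ^ k * (zs * t)) ∈ P ∧ cls α lam (zs ^ k * (zw α * t)) ∈ P ∧
      cls α lam (zs ^ k * (zv 2 * t)) ∈ P ∧ cls α lam (zs ^ k * (zv 3 * t)) ∈ P := by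
    obtain rfl | ht := ht
    · rw [hzs, mul_one (zw α), mul_one (zv 2), mul_one (zv 3)]
      exact ⟨hg _, h2 k⟩
    · refine (forall_lowH (P := fun t => cls α lam (zs ^ k * (zs * t)) ∈ P ∧
        cls α lam (zs ^ k * (zw α * t)) ∈ P ∧ cls α lam (zs ^ k * (zv 2 * t)) ∈ P ∧
        cls α lam (zs ^ k * (zv 3 * t)) ∈ P)).2 ⟨⟨hsw, ww, ?_, ?_⟩, ⟨hs2, w2, ?_, h32⟩, hs3, w3, h23, ?_⟩ t ht
      · rw [c2]; exact w2
      · rw [c3]; exact w3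
      · rw [zv_two_sq]; exact h0
      · rw [zv_three_sq]; exact h0
  obtain ⟨k0, k1, k2, k3⟩ := key
  have := add_mem (lin _ _ y0 y1 k0 k1) (lin _ _ y2 y3 k2 k3)
  convert this using 1
  rw [← map_add, ← mul_add, hy]
  simp only [add_mul, smul_mul_assoc, add_assoc]

/-- The sum contains `1`, and `z₁ + z₂` is central, so stability under multiplication by `zᵢ`
reduces to `zᵢ` acting on lowest vectors. -/
lemma genSub_sup_eq_top (hs : Standing α lam) (hα : 1 + α ≠ 0) :
    genSub α lam {1} ⊔ genSub α lam (lowH α) = ⊤ := by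
  set P := genSub α lam {1} ⊔ genSub α lam (lowH α) with hP
  have hne : -2 * Complex.I ≠ 0 := by simp
  have hR : ∀ i k t, (t = 1 ∨ t ∈ lowH α) →
      rho hs ((cayley α).symm (gMinus α (bas i))) (cls α lam (zs ^ k * t)) ∈ P := by
    intro i k t ht
    have hc : zv i * (zs ^ k * t) = zs ^ k * (zv i * t) := by
      rw [← mul_assoc, ← ((zs_commute (zv i)).pow_left k).eq, mul_assoc]
    rw [rho_gMinus, vecPoly_bas, hc]
    exact Submodule.smul_mem _ _ (zs_pow_mul_zv_mul_mem hs hα i k ht)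
  refine eq_top_of_vecPoly_mul _ ?_ ?_
  · have := cls_mem_genSub (α := α) (lam := lam) (S := {1}) 0 (Submodule.subset_span rfl)
    rw [pow_zero, mul_one] at this
    exact Submodule.mem_sup_left this
  · intro i p hp
    have hle : P ≤ P.comap (rho hs ((cayley α).symm (gMinus α (bas i)))) :=
      sup_le (genSub_le_iff.2 fun k t ht => hR i k t (Or.inl ht))
        (genSub_le_iff.2 fun k t ht => hR i k t (Or.inr ht))
    have := hle hp
    rw [Submodule.mem_comap, rho_gMinus, vecPoly_bas] at this
    exact (Submodule.smul_mem_iff _ hne).1 this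

/-- The two subspaces lie in Casimir eigenspaces with eigenvalues `0` (degree `d = 0`) and `μ`
(degree `d = 1`), which differ. -/
lemma genSub_inf_eq_bot (hs : Standing α lam) (hμ : lam + lam / α ≠ 0) :
    genSub α lam {1} ⊓ genSub α lam (lowH α) = ⊥ := by
  have h1 : genSub α lam {1} ≤ LinearMap.ker (casimir hs) := by
    refine genSub_le_iff.2 ?_
    rintro k _ rfl
    rw [LinearMap.mem_ker, casimir_zs_pow hs (euler_low α).1 (bessel_low hs.ne_zero lam).1]
    simp
  have h2 : genSub α lam (lowH α) ≤ LinearMap.ker (casimir hs - (lam + lam / α) • 1) := by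
    refine genSub_le_iff.2 fun k t ht => ?_
    rw [LinearMap.mem_ker, LinearMap.sub_apply,
      casimir_zs_pow hs (euler_lowH t ht) (bessel_lowH hs.ne_zero lam t ht), LinearMap.smul_apply,
      Module.End.one_apply]
    module
  refine eq_bot_iff.2 fun x hx => ?_
  have e1 := LinearMap.mem_ker.1 (h1 hx.1)
  have e2 := LinearMap.mem_ker.1 (h2 hx.2)
  rw [LinearMap.sub_apply, e1, LinearMap.smul_apply, Module.End.one_apply, zero_sub, neg_eq_zero,
    smul_eq_zero] at e2
  exact e2.resolve_left hμ

/-! ### Directness of the sums and nonvanishing of the constants -/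

lemma iSupIndep_of_le_eigenspace {V : Type*} [AddCommGroup V] [Module ℂ V] (T : Module.End ℂ V)
    {P : ℕ → Submodule ℂ V} (μ : ℂ) (h : ∀ k, P k ≤ T.eigenspace (μ - 2 * k)) : iSupIndep P := by
  have hinj : Function.Injective fun k : ℕ => μ - 2 * (k : ℂ) := by
    intro k l hkl
    simpa using hkl
  exact (T.eigenspaces_iSupIndep.comp hinj).mono h

lemma iSupIndep_gComp (hs : Standing α lam) : iSupIndep (gComp α lam) := by
  refine iSupIndep_of_le_eigenspace (rho hs (hTil α)) (lam + lam / α) fun k => ?_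
  rw [gComp_eq, Submodule.span_singleton_le_iff_mem, Module.End.mem_eigenspace_iff,
    rho_hTil_zs_pow hs (euler_low α).1, add_zero]

lemma iSupIndep_hComp (hs : Standing α lam) : iSupIndep (hComp α lam) := by
  -- The shift by `-2` appears because `hComp α lam k` has Euler degree `k + 1`.
  refine iSupIndep_of_le_eigenspace (rho hs (hTil α)) (lam + lam / α - 2) fun k => ?_
  have h : ∀ t ∈ lowH α, cls α lam (zs ^ k * t) ∈
      (rho hs (hTil α)).eigenspace (lam + lam / α - 2 - 2 * k) := fun t ht => by
    rw [Module.End.mem_eigenspace_iff, rho_hTil_zs_pow hs (euler_lowH t ht)]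
    congr 1
    ring
  obtain ⟨h1, h2, h3⟩ := forall_lowH.1 h
  rw [hComp_eq hs, Submodule.span_le]
  rintro _ (rfl | rfl | rfl)
  exacts [h1, h2, h3]

lemma add_ne_zero_of_ne_neg_one (h : (lam = α ∧ (∀ n : ℕ, α ≠ n) ∧ α ≠ -1) ∨
    (lam = 1 ∧ (∀ n : ℕ, α⁻¹ ≠ n) ∧ α⁻¹ ≠ -1)) : 1 + α ≠ 0 := by
  intro h0
  have hα : α = -1 := by linear_combination h0
  obtain ⟨-, -, h⟩ | ⟨-, -, h⟩ := h
  · exact h hα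
  · exact h (by rw [hα]; norm_num)

lemma weight_ne_zero (hs : Standing α lam) (hα : 1 + α ≠ 0) : lam + lam / α ≠ 0 := by
  have hl : lam ≠ 0 := by
    obtain rfl | rfl := hs.eq_or
    · exact hs.ne_zero
    · exact one_ne_zero
  have e : lam + lam / α = lam * (1 + α) / α := by
    have := hs.ne_zero
    field_simp
    ring
  rw [e]
  exact div_ne_zero (mul_ne_zero hl hα) hs.ne_zero

end FockD21
end

theorem mainTheorem9 (α lam : ℂ) (hs : FockD21.Standing α lam)
    (h : (lam = α ∧ (∀ n : ℕ, α ≠ n) ∧ α ≠ -1) ∨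
      (lam = 1 ∧ (∀ n : ℕ, α⁻¹ ≠ n) ∧ α⁻¹ ≠ -1)) :
    (FockD21.tkkBracket α (FockD21.hTil α) (FockD21.eTil α) = (2 : ℂ) • FockD21.eTil α ∧
      FockD21.tkkBracket α (FockD21.hTil α) (FockD21.fTil α) = (-2 : ℂ) • FockD21.fTil α ∧
      FockD21.tkkBracket α (FockD21.eTil α) (FockD21.fTil α) = FockD21.hTil α) ∧
    (∀ X ∈ FockD21.sAlg α, ∀ Y ∈ FockD21.k0 α, FockD21.tkkBracket α X Y = 0) ∧
    (∀ X, X ∈ FockD21.sAlg α ∨ X ∈ FockD21.k0 α →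
      (∀ p ∈ FockD21.fockG α lam, FockD21.rho hs X p ∈ FockD21.fockG α lam) ∧
      (∀ p ∈ FockD21.fockH α lam, FockD21.rho hs X p ∈ FockD21.fockH α lam)) ∧
    (iSupIndep (FockD21.gComp α lam) ∧ iSupIndep (FockD21.hComp α lam)) ∧
    (FockD21.fockG α lam ⊓ FockD21.fockH α lam = ⊥ ∧
      FockD21.fockG α lam ⊔ FockD21.fockH α lam = FockD21.fockF hs) := by
  have hα := FockD21.add_ne_zero_of_ne_neg_one h
  refine ⟨FockD21.sl2_triple α, FockD21.bracket_sAlg_k0 α, ?_,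
    ⟨FockD21.iSupIndep_gComp hs, FockD21.iSupIndep_hComp hs⟩, ?_, ?_⟩
  · rw [FockD21.fockG_eq, FockD21.fockH_eq hs]
    have h1 : ∀ t ∈ ({1} : Set FockD21.SPoly), FockD21.euler t = (0 : ℂ) • t := by
      rintro _ rfl; exact (FockD21.euler_low α).1
    have h2 : ∀ t ∈ ({1} : Set FockD21.SPoly), FockD21.bessel α lam FockD21.unitJ t = 0 := by
      rintro _ rfl; exact (FockD21.bessel_low hs.ne_zero lam).1
    rintro X (hX | hX)
    · exact ⟨fun p hp => FockD21.rho_sAlg_genSub hs h1 h2 hX hp,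
        fun p hp => FockD21.rho_sAlg_genSub hs FockD21.euler_lowH
          (FockD21.bessel_lowH hs.ne_zero lam) hX hp⟩
    · refine ⟨fun p hp => FockD21.rho_k0_genSub hs ?_ hX hp,
        fun p hp => FockD21.rho_k0_genSub hs FockD21.derOp_lowH hX hp⟩
      rintro u v p q r _ rfl
      rw [(FockD21.derOp_low α u v p q r).1]
      exact zero_mem _
  · rw [FockD21.fockG_eq, FockD21.fockH_eq hs]
    exact FockD21.genSub_inf_eq_bot hs (FockD21.weight_ne_zero hs hα)
  · rw [FockD21.fockG_eq, FockD21.fockH_eq hs, FockD21.fockF_eq_top hs]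
    exact FockD21.genSub_sup_eq_top hs hα
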